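/- Let $N$ be a random variable with values in $\{0,1,2,\dots\}$ and let $C,Q$ be non-negative real random variables. Consider the random tree with root $\emptyset$ whose potential individuals are the finite sequences $(i_1,\dots,i_n)$, $n\ge 0$, of positive integers. To every potential individual $v$ attach random variables $N_v, C_v, Q_v$ distributed as $N$, $C$, $Q$ respectively, all of these random variables being mutually independent. Put $A_0=\{\emptyset\}$ and, for $n\ge 1$, $$A_n=\{(i_1,\dots,i_n):\ (i_1,\dots,i_{n-1})\in A_{n-1},\ 1\le i_n\le N_{(i_1,\dots,i_{n-1})}\},$$ and let $$W_n=\sum_{(i_1,\dots,i_n)\in A_n} Q_{(i_1,\dots,i_n)}\prod_{k=1}^n C_{(i_1,\dots,i_k)},\qquad n\ge 0,$$ be the total weight of the $n$th generation. Suppose that, for some $\alpha>1$, $P(N>x)=x^{-\alpha}L(x)$ for all $x>0$, where $L:[0,\infty)\to(0,\infty)$ is slowly varying, i.e. $L(\lambda x)/L(x)\to 1$ as $x\to\infty$ for every $\lambda>0$. Suppose further that $E[C^{\alpha+\nu}]<\infty$ and $E[Q^{\alpha+\nu}]<\infty$ for some $\nu>0$, and let $\eta$ satisfy $$E[N]\,\max\{E[C^\alpha],E[C]\}<\eta<1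 .$$ Then there exists a constant $K>0$ such that, for all integers $n\ge 1$ and all real $x\ge 1$, $$P(W_n>x)\le K\,\eta^n\,P(N>x).$$ -/

import Mathlib

open MeasureTheory ProbabilityTheory Filter Topology

/-- `L` is slowly varying (at infinity): it is positive on `[0, ∞)` and
`L (l * x) / L x → 1` as `x → ∞`, for every `l > 0`. -/
def SlowlyVarying (L : ℝ → ℝ) : Prop :=
  (∀ x : ℝ, 0 ≤ x → 0 < L x) ∧
    ∀ l : ℝ, 0 < l → Tendsto (fun x : ℝ => L (l * x) / L x) atTop (𝓝 1)

namespace WeightedBranching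

/-- The `n`-th generation `A n` of the family tree in which the individual `v` has `N v` children.
The root is the empty list and the children of `v` are the lists `v ++ [i]` with `i < N v`
(siblings are numbered from `0`). -/
def generation (N : List ℕ → ℕ) : ℕ → Finset (List ℕ)
  | 0 => {[]}
  | n + 1 => (generation N n).biUnion fun v => (Finset.range (N v)).image fun i => v ++ [i]

/-- The weight of the individual `v = (i₁, …, iₙ)`: the product of the factors
`C (i₁) * C (i₁, i₂) * ⋯ * C (i₁, …, iₙ)` along the branch that leads from the root to `v`;
the root has weight `1`. -/
noncomputable def branchWeight (C : List ℕ → ℝ) (v : List ℕ) : ℝ :=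
  ∏ k ∈ Finset.range v.length, C (v.take (k + 1))

/-- The total weight `W n` of the `n`-th generation: the sum of `Q v` times the weight of `v`
over the individuals `v` of generation `n`. -/
noncomputable def totalWeight (N : List ℕ → ℕ) (C Q : List ℕ → ℝ) (n : ℕ) : ℝ :=
  ∑ v ∈ generation N n, Q v * branchWeight C v

/-- The families `Nt`, `Ct`, `Qt`, indexed by all potential individuals, consist of copies of
`N`, `C`, `Q` respectively, and all these random variables together are mutually independent. -/
structure IsIIDTree {Ω : Type*} [MeasurableSpace Ω] (P : Measure Ω)
    (N : Ω → ℕ) (C Q : Ω → ℝ)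
    (Nt : List ℕ → Ω → ℕ) (Ct Qt : List ℕ → Ω → ℝ) : Prop where
  measurable_N : ∀ v, Measurable (Nt v)
  measurable_C : ∀ v, Measurable (Ct v)
  measurable_Q : ∀ v, Measurable (Qt v)
  identDistrib_N : ∀ v, IdentDistrib (Nt v) N P P
  identDistrib_C : ∀ v, IdentDistrib (Ct v) C P P
  identDistrib_Q : ∀ v, IdentDistrib (Qt v) Q P P
  indep : iIndepFun
    (Sum.elim (fun v ω => (Nt v ω : ℝ)) (Sum.elim Ct Qt) :
      List ℕ ⊕ (List ℕ ⊕ List ℕ) → Ω → ℝ) P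

end WeightedBranching

namespace WeightedBranching

open scoped ENNReal

/-! Write T(x) = P(N > x) and u = η^n. Splitting the tree at the root gives W_{n+1} = ∑_{i<N} C_i
W_n^{(i)}, where N, the factors C_i and the subtree weights W_n^{(i)} are independent. Two facts
pass from generation n to n + 1. The mean satisfies E W_n ≤ (E N · E C)^n E Q ≤ E Q · u
(`lintegral_weight_le`), and a tail bound P(W_n > y) ≤ K u T(y) for y ≥ 1 becomes P(W_{n+1} > x) ≤
(θK + c) u T(x) for x ≥ x₀, with θ < η and with c, x₀ independent of K and n (`exists_tail_succ`). A
large K then closes the induction, since θK + c ≤ ηK; for 1 ≤ x ≤ x₀ Markov's inequality suffices.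

The tail step is a one-big-jump argument (`measure_sum_random_gt_le`). Fix l < 1 close to 1 and κ
small. If the sum exceeds x, then one of the following happens. (a) N > M = x/u. Potter's bound with
exponent 1 < α gives T(M) ≤ const · u T(x). (b) One summand exceeds lx. A Breiman-type estimate
(`RegularTail.measure_mul_gt_le`) bounds P(C W_n > y) by about E[C^α] K u T(y), so this costs about
E N · E[C^α] · l^{-α} K u T(x), whose coefficient of K is below η. This is the main term. (c) Two
summands exceed κx. Compared with (b) there is an extra factor tending to 0 as x → ∞. (d) The
summands below κx add up to more than (1-l)x. A Rosenthal inequality of high order p + 1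
(`lintegral_sum_pow_le`) bounds this by a moment term, small in K because κ is small, and a mean
term, controlled by E W_n and the cut N ≤ M, which is free of K. -/

/-! ### Regularly varying tails and Potter bounds. -/

/-- `T` is positive, nonincreasing and regularly varying with index `-α` on `(0, ∞)`. -/
structure RegularTail (T : ℝ → ℝ) (α : ℝ) : Prop where
  pos : ∀ x, 0 < x → 0 < T x
  anti : Antitone T
  lim : ∀ l, 0 < l → Tendsto (fun x => T (l * x) / T x) atTop (𝓝 (l ^ (-α)))

/-- No sign condition is put on `f`, so the lemma also serves for `-T`, turning lower bounds into
upper ones. -/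
theorem iterate_doubling_le {f : ℝ → ℝ} {r x₀ : ℝ} (hr : 0 ≤ r) (hx₀ : 0 ≤ x₀)
    (h : ∀ x, x₀ ≤ x → f (2 * x) ≤ r * f x) (k : ℕ) {x : ℝ} (hx : x₀ ≤ x) :
    f (2 ^ k * x) ≤ r ^ k * f x := by
  induction k with
  | zero => simp
  | succ k ih =>
    have h1 : x₀ ≤ 2 ^ k * x := by
      have : (1 : ℝ) ≤ 2 ^ k := one_le_pow₀ (by norm_num)
      nlinarith
    calc f (2 ^ (k + 1) * x) = f (2 * (2 ^ k * x)) := by ring_nf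
      _ ≤ r * f (2 ^ k * x) := h _ h1
      _ ≤ r * (r ^ k * f x) := by gcongr
      _ = r ^ (k + 1) * f x := by ring

theorem RegularTail.eventually_upper {T : ℝ → ℝ} {α b : ℝ} (hT : RegularTail T α) (hb : b < α) :
    ∃ x₀ : ℝ, 1 ≤ x₀ ∧ ∀ x, x₀ ≤ x → T (2 * x) ≤ 2 ^ (-b) * T x := by
  have h1 : (2 : ℝ) ^ (-α) < 2 ^ (-b) :=
    Real.rpow_lt_rpow_of_exponent_lt (by norm_num) (by linarith)
  obtain ⟨x₀, hx₀⟩ := eventually_atTop.1 ((hT.lim 2 (by norm_num)).eventually_lt_const h1)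
  refine ⟨max x₀ 1, le_max_right _ _, fun x hx => ?_⟩
  have hx1 : 0 < x := by linarith [le_max_right x₀ 1]
  have := hx₀ x (le_trans (le_max_left _ _) hx)
  rw [div_lt_iff₀ (hT.pos x hx1)] at this
  exact this.le

theorem RegularTail.eventually_lower {T : ℝ → ℝ} {α a : ℝ} (hT : RegularTail T α) (ha : α < a) :
    ∃ x₀ : ℝ, 1 ≤ x₀ ∧ ∀ x, x₀ ≤ x → T x ≤ 2 ^ a * T (2 * x) := by
  have h1 : (2 : ℝ) ^ (-a) < 2 ^ (-α) :=
    Real.rpow_lt_rpow_of_exponent_lt (by norm_num) (by linarith)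
  obtain ⟨x₀, hx₀⟩ := eventually_atTop.1 ((hT.lim 2 (by norm_num)).eventually_const_lt h1)
  refine ⟨max x₀ 1, le_max_right _ _, fun x hx => ?_⟩
  have hx1 : 0 < x := by linarith [le_max_right x₀ 1]
  have := hx₀ x (le_trans (le_max_left _ _) hx)
  rw [lt_div_iff₀ (hT.pos x hx1), Real.rpow_neg (by norm_num), inv_mul_lt_iff₀ (by positivity)]
    at this
  exact this.le

theorem two_pow_rpow_le {t b : ℝ} {k : ℕ} (ht : 0 ≤ t) (hk : t ≤ 2 ^ (k + 1)) (hb : 0 ≤ b) :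
    t ^ b ≤ 2 ^ b * ((2 : ℝ) ^ b) ^ k := by
  calc t ^ b ≤ ((2 : ℝ) ^ (k + 1)) ^ b := Real.rpow_le_rpow ht hk hb
    _ = ((2 : ℝ) ^ b) ^ (k + 1) := by
        rw [← Real.rpow_natCast, ← Real.rpow_natCast, ← Real.rpow_mul (by norm_num),
          ← Real.rpow_mul (by norm_num), mul_comm]
    _ = _ := by ring

/-- Potter's upper bound for a regularly varying tail. -/
theorem RegularTail.potter_upper {T : ℝ → ℝ} {α b : ℝ} (hT : RegularTail T α) (hb0 : 0 ≤ b)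
    (hb : b < α) :
    ∃ A : ℝ, 0 < A ∧ ∀ y z, 1 ≤ y → y ≤ z → T z ≤ A * (y / z) ^ b * T y := by
  obtain ⟨x₀, hx1, h⟩ := hT.eventually_upper hb
  have hx0 : 0 < x₀ := by linarith
  have key : ∀ y z, x₀ ≤ y → y ≤ z → T z ≤ 2 ^ b * (y / z) ^ b * T y := by
    intro y z hy hyz
    have hy0 : 0 < y := by linarith
    have hz0 : 0 < z := by linarith
    -- Round `z / y` down to a power of two: monotonicity of `T` handles the remainder, at the cost
    -- of the factor `2 ^ b`.
    obtain ⟨k, hk1, hk2⟩ := exists_nat_pow_near ((one_le_div hy0).2 hyz) (one_lt_two (α := ℝ))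
    have h1 : T z ≤ (2 ^ (-b)) ^ k * T y :=
      (hT.anti ((le_div_iff₀ hy0).1 hk1)).trans
        (iterate_doubling_le (by positivity) hx0.le h k hy)
    refine h1.trans (mul_le_mul_of_nonneg_right ?_ (hT.pos y hy0).le)
    have h2 := two_pow_rpow_le (by positivity) hk2.le hb0
    have h3 : (y / z) ^ b = ((z / y) ^ b)⁻¹ := by
      rw [← Real.inv_rpow (by positivity), inv_div]
    rw [h3, Real.rpow_neg (by norm_num), inv_pow, ← div_eq_mul_inv, le_div_iff₀ (by positivity),
      inv_mul_le_iff₀ (by positivity)]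
    linarith
  -- Arguments in `[1, x₀]` are compared with `x₀` by monotonicity; the factor `x₀ ^ b` pays for the
  -- change in the ratio.
  refine ⟨2 ^ b * x₀ ^ b, by positivity, fun y z hy hyz => ?_⟩
  have hy0 : 0 < y := by linarith
  have hz0 : 0 < z := by linarith
  have h2b : (1 : ℝ) ≤ 2 ^ b := Real.one_le_rpow (by norm_num) hb0
  have hTy := hT.pos y hy0
  rcases le_total x₀ y with hxy | hxy
  · refine (key y z hxy hyz).trans ?_
    have : (1 : ℝ) ≤ x₀ ^ b := Real.one_le_rpow hx1 hb0
    gcongr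
    nlinarith
  rcases le_total z x₀ with hzx | hzx
  · have h1 : 1 ≤ x₀ ^ b * (y / z) ^ b := by
      rw [← Real.mul_rpow hx0.le (by positivity)]
      refine Real.one_le_rpow ?_ hb0
      rw [← mul_div_assoc, one_le_div hz0]
      nlinarith
    have h2 : 1 ≤ 2 ^ b * x₀ ^ b * (y / z) ^ b := by
      rw [mul_assoc]; exact one_le_mul_of_one_le_of_one_le h2b h1
    exact (hT.anti hyz).trans (le_mul_of_one_le_left hTy.le h2)
  · refine (key x₀ z le_rfl hzx).trans ?_
    have h1 : (x₀ / z) ^ b ≤ x₀ ^ b * (y / z) ^ b := by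
      rw [← Real.mul_rpow hx0.le (by positivity), ← mul_div_assoc]
      refine Real.rpow_le_rpow (by positivity) ?_ hb0
      gcongr
      nlinarith
    have h3 := hT.anti hxy
    have h4 := (hT.pos x₀ hx0).le
    calc 2 ^ b * (x₀ / z) ^ b * T x₀ ≤ 2 ^ b * (x₀ ^ b * (y / z) ^ b) * T y := by gcongr
      _ = _ := by ring

/-- Potter's lower bound for a regularly varying tail. -/
theorem RegularTail.potter_lower {T : ℝ → ℝ} {α a : ℝ} (hT : RegularTail T α) (ha0 : 0 ≤ a)
    (ha : α < a) :
    ∃ A : ℝ, 0 < A ∧ ∀ y z, 1 ≤ y → y ≤ z → T y ≤ A * (z / y) ^ a * T z := by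
  obtain ⟨x₀, hx1, h⟩ := hT.eventually_lower ha
  have hx0 : 0 < x₀ := by linarith
  have key : ∀ y z, x₀ ≤ y → y ≤ z → T y ≤ 2 ^ a * (z / y) ^ a * T z := by
    intro y z hy hyz
    have hy0 : 0 < y := by linarith
    have hz0 : 0 < z := by linarith
    obtain ⟨k, hk1, hk2⟩ := exists_nat_pow_near ((one_le_div hy0).2 hyz) (one_lt_two (α := ℝ))
    -- Here `z / y` is rounded up, hence `k + 1` doublings, applied to `-T`.
    have h1 := iterate_doubling_le (f := fun x => - T x) (r := 2 ^ (-a)) (by positivity) hx0.le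
      (fun x hx => by
        have := h x hx
        have h3 : (2 : ℝ) ^ (-a) * 2 ^ a = 1 := by rw [← Real.rpow_add (by norm_num)]; simp
        have h4 : (0 : ℝ) < 2 ^ (-a) := by positivity
        have h6 := mul_le_mul_of_nonneg_left this h4.le
        rw [← mul_assoc, h3, one_mul] at h6
        linarith) (k + 1) hy
    have h2 : T (2 ^ (k + 1) * y) ≤ T z := hT.anti ((div_le_iff₀ hy0).1 hk2.le)
    have h5 : (2 ^ (-a)) ^ (k + 1) * T y ≤ T z := by linarith
    rw [Real.rpow_neg (by norm_num), inv_pow, inv_mul_le_iff₀ (by positivity)] at h5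
    refine h5.trans (mul_le_mul_of_nonneg_right ?_ (hT.pos z hz0).le)
    rw [pow_succ, mul_comm]
    refine mul_le_mul_of_nonneg_left ?_ (by positivity)
    rw [← Real.rpow_natCast, ← Real.rpow_mul (by norm_num), mul_comm,
      Real.rpow_mul (by norm_num), Real.rpow_natCast]
    exact Real.rpow_le_rpow (by positivity) hk1 ha0
  -- The factor `T 1 / T x₀` is the largest possible loss when `T y` with `1 ≤ y ≤ x₀` is replaced
  -- by `T x₀`.
  refine ⟨2 ^ a * x₀ ^ a * (T 1 / T x₀), by
    have := hT.pos 1 one_pos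
    have := hT.pos x₀ hx0
    positivity, fun y z hy hyz => ?_⟩
  have hy0 : 0 < y := by linarith
  have hz0 : 0 < z := by linarith
  have h2a : (1 : ℝ) ≤ 2 ^ a := Real.one_le_rpow (by norm_num) ha0
  have hxa : (1 : ℝ) ≤ x₀ ^ a := Real.one_le_rpow hx1 ha0
  have hza : (1 : ℝ) ≤ (z / y) ^ a := Real.one_le_rpow ((one_le_div hy0).2 hyz) ha0
  have hTz := hT.pos z hz0
  have hTx := hT.pos x₀ hx0
  have hT1 : 1 ≤ T 1 / T x₀ := (one_le_div hTx).2 (hT.anti hx1)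
  rcases le_total x₀ y with hxy | hxy
  · refine (key y z hxy hyz).trans ?_
    gcongr
    calc (2 : ℝ) ^ a = 2 ^ a * 1 * 1 := by ring
      _ ≤ 2 ^ a * x₀ ^ a * (T 1 / T x₀) := by gcongr
  have hy1 : T y ≤ T 1 / T x₀ * T x₀ := by
    rw [div_mul_cancel₀ _ hTx.ne']; exact hT.anti hy
  refine hy1.trans ?_
  rcases le_total z x₀ with hzx | hzx
  · calc T 1 / T x₀ * T x₀ ≤ T 1 / T x₀ * T z := by gcongr; exact hT.anti hzx
      _ = 1 * 1 * (T 1 / T x₀) * 1 * T z := by ring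
      _ ≤ _ := by gcongr
  · calc T 1 / T x₀ * T x₀ ≤ T 1 / T x₀ * (2 ^ a * (z / x₀) ^ a * T z) := by
          gcongr; exact key x₀ z le_rfl hzx
      _ ≤ T 1 / T x₀ * (2 ^ a * (x₀ ^ a * (z / y) ^ a) * T z) := by
          gcongr
          rw [← Real.mul_rpow hx0.le (by positivity)]
          refine Real.rpow_le_rpow (by positivity) ?_ ha0
          rw [div_le_iff₀ hx0]
          have : z ≤ x₀ * (z / y) := by
            rw [← mul_div_assoc, le_div_iff₀ hy0]; nlinarith
          nlinarith
      _ = _ := by ring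

theorem RegularTail.of_slowlyVarying {T L : ℝ → ℝ} {α : ℝ} (hL : SlowlyVarying L)
    (hanti : Antitone T) (hT : ∀ x, 0 < x → T x = x ^ (-α) * L x) : RegularTail T α where
  pos x hx := by
    rw [hT x hx]; exact mul_pos (Real.rpow_pos_of_pos hx _) (hL.1 x hx.le)
  anti := hanti
  lim l hl := by
    have h := (hL.2 l hl).const_mul (l ^ (-α))
    rw [mul_one] at h
    refine h.congr' ?_
    filter_upwards [eventually_gt_atTop 0] with x hx
    rw [hT x hx, hT _ (mul_pos hl hx), Real.mul_rpow hl.le hx.le]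
    have := (Real.rpow_pos_of_pos hx (-α)).ne'
    have := (hL.1 x hx.le).ne'
    field_simp

/-! ### Moments and tails of sums with a deterministic number of terms. -/

theorem ennreal_add_pow_le (a b : ℝ≥0∞) (n : ℕ) : (a + b) ^ n ≤ 2 ^ n * (a ^ n + b ^ n) := by
  rcases le_total a b with h | h
  · calc (a + b) ^ n ≤ (2 * b) ^ n := by rw [two_mul]; gcongr
      _ = 2 ^ n * b ^ n := mul_pow _ _ _
      _ ≤ _ := by gcongr; exact le_add_self
  · calc (a + b) ^ n ≤ (2 * a) ^ n := by rw [two_mul]; gcongr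
      _ = 2 ^ n * a ^ n := mul_pow _ _ _
      _ ≤ _ := by gcongr; exact le_self_add

/-- A crude Young inequality: compare `s` with `2 * b`. The coefficient 1/2 lets the first term be
absorbed on the left in the Rosenthal argument. -/
theorem ennreal_mul_pow_le (b s : ℝ≥0∞) (n : ℕ) :
    b * s ^ n ≤ 2⁻¹ * s ^ (n + 1) + (2 * b) ^ (n + 1) := by
  rcases le_total (2 * b) s with h | h
  · refine le_add_right ?_
    calc b * s ^ n = 2⁻¹ * (2 * b) * s ^ n := by
          rw [← mul_assoc, ENNReal.inv_mul_cancel (by simp) (by simp), one_mul]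
      _ ≤ 2⁻¹ * s * s ^ n := by gcongr
      _ = _ := by ring
  · refine le_add_left ?_
    calc b * s ^ n ≤ (2 * b) * (2 * b) ^ n := by
          gcongr
          exact le_mul_of_one_le_left (by simp) (by norm_num)
      _ = _ := by ring

/-- A Rosenthal-type inequality for sums of bounded nonnegative random variables. -/
theorem lintegral_sum_pow_le {Ω : Type*} [MeasurableSpace Ω] {P : Measure Ω}
    [IsProbabilityMeasure P] {Y : ℕ → Ω → ℝ≥0∞} (hm : ∀ i, Measurable (Y i))
    (hind : ∀ i (s : Finset ℕ), i ∉ s → IndepFun (Y i) (fun ω => ∑ j ∈ s, Y j ω) P)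
    {k : ℝ≥0∞} (hk : k ≠ ∞) (hYk : ∀ i ω, Y i ω ≤ k) (p : ℕ) {A μ : ℝ≥0∞}
    (hA : ∀ i, ∫⁻ ω, Y i ω ^ (p + 1) ∂P ≤ A) (hμ : ∀ i, ∫⁻ ω, Y i ω ∂P ≤ μ) (m : ℕ) :
    ∫⁻ ω, (∑ i ∈ Finset.range m, Y i ω) ^ (p + 1) ∂P
      ≤ (2 ^ (p + 1)) ^ (p + 2) * (m * A + (m * μ) ^ (p + 1)) := by
  set S : Ω → ℝ≥0∞ := fun ω => ∑ i ∈ Finset.range m, Y i ω with hS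
  have hSm : Measurable S := Finset.measurable_sum _ fun i _ => hm i
  set a := ∫⁻ ω, S ω ^ (p + 1) ∂P with ha
  set c := ∫⁻ ω, S ω ^ p ∂P with hc
  have hSk : ∀ ω, S ω ≤ m * k := fun ω => by
    calc S ω ≤ ∑ _i ∈ Finset.range m, k := Finset.sum_le_sum fun i _ => hYk i ω
      _ = m * k := by simp
  -- Boundedness of the summands is used only here: absorbing half of `a` requires `a` to be finite.
  have hafin : a ≠ ∞ := by
    refine ne_top_of_le_ne_top (b := (m * k) ^ (p + 1)) (by finiteness) ?_
    calc a ≤ ∫⁻ _, (m * k) ^ (p + 1) ∂P := by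
          refine lintegral_mono fun ω => ?_
          simp only
          gcongr
          exact hSk ω
      _ = _ := by simp
  have h1 : a ≤ 2 ^ p * (m * A) + 2 ^ p * (m * μ) * c := by
    -- Write S^(p+1) = ∑ Y_i S^p and split S = Y_i + R with R independent of Y_i; the order of the
    -- moment of R drops to p.
    calc a = ∑ i ∈ Finset.range m, ∫⁻ ω, Y i ω * S ω ^ p ∂P := by
          rw [← lintegral_finsetSum _ (fun i _ => by fun_prop), ha]
          refine lintegral_congr fun ω => ?_
          rw [← Finset.sum_mul, pow_succ']
      _ ≤ ∑ _i ∈ Finset.range m, (2 ^ p * (A + μ * c)) := by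
          refine Finset.sum_le_sum fun i hi => ?_
          set R : Ω → ℝ≥0∞ := fun ω => ∑ j ∈ (Finset.range m).erase i, Y j ω with hR
          have hRm : Measurable R := Finset.measurable_sum _ fun i _ => hm i
          have hSR : ∀ ω, S ω = Y i ω + R ω := fun ω => (Finset.add_sum_erase _ _ hi).symm
          have hind' : IndepFun (Y i) (fun ω => R ω ^ p) P :=
            (hind i _ (Finset.notMem_erase i _)).comp (φ := id) (ψ := fun x => x ^ p)
              measurable_id (by fun_prop)
          calc ∫⁻ ω, Y i ω * S ω ^ p ∂P
              ≤ ∫⁻ ω, 2 ^ p * (Y i ω ^ (p + 1) + Y i ω * R ω ^ p) ∂P := by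
                refine lintegral_mono fun ω => ?_
                simp only
                rw [hSR]
                calc Y i ω * (Y i ω + R ω) ^ p
                    ≤ Y i ω * (2 ^ p * (Y i ω ^ p + R ω ^ p)) := by
                      gcongr; exact ennreal_add_pow_le _ _ _
                  _ = _ := by ring
            _ = 2 ^ p * (∫⁻ ω, Y i ω ^ (p + 1) ∂P +
                  (∫⁻ ω, Y i ω ∂P) * ∫⁻ ω, R ω ^ p ∂P) := by
                rw [lintegral_const_mul _ (by fun_prop), lintegral_add_left (by fun_prop),
                  lintegral_mul_eq_lintegral_mul_lintegral_of_indepFun'' (hm i).aemeasurable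
                    (by fun_prop) hind']
            _ ≤ 2 ^ p * (A + μ * c) := by
                gcongr
                · exact hA i
                · exact hμ i
                · refine lintegral_mono fun ω => ?_
                  simp only
                  gcongr
                  rw [hSR]
                  exact le_add_self
      _ = _ := by simp; ring
  have h2 : 2 ^ p * (m * μ) * c ≤ 2⁻¹ * a + (2 * (2 ^ p * (m * μ))) ^ (p + 1) := by
    calc 2 ^ p * (m * μ) * c = ∫⁻ ω, 2 ^ p * (m * μ) * S ω ^ p ∂P := by
          rw [lintegral_const_mul _ (by fun_prop)]
      _ ≤ ∫⁻ ω, (2⁻¹ * S ω ^ (p + 1) + (2 * (2 ^ p * (m * μ))) ^ (p + 1)) ∂P :=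
          lintegral_mono fun ω => ennreal_mul_pow_le _ _ _
      _ = _ := by
          rw [lintegral_add_left (by fun_prop), lintegral_const_mul _ (by fun_prop)]
          simp [ha]
  have h3 : a ≤ 2⁻¹ * a + (2 ^ p * (m * A) + (2 ^ (p + 1) * (m * μ)) ^ (p + 1)) := by
    refine (h1.trans (add_le_add_right h2 _)).trans (le_of_eq ?_)
    ring
  have h4 : a ≤ 2 * (2 ^ p * (m * A) + (2 ^ (p + 1) * (m * μ)) ^ (p + 1)) := by
    have h5 : a = 2⁻¹ * a + 2⁻¹ * a := by
      rw [← add_mul, ENNReal.inv_two_add_inv_two, one_mul]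
    have h6 : 2⁻¹ * a ≤ 2 ^ p * (m * A) + (2 ^ (p + 1) * (m * μ)) ^ (p + 1) := by
      refine (ENNReal.add_le_add_iff_left (a := 2⁻¹ * a) (by finiteness)).1 ?_
      rwa [← h5]
    calc a = 2 * (2⁻¹ * a) := by
          rw [← mul_assoc, ENNReal.mul_inv_cancel (by simp) (by simp), one_mul]
      _ ≤ _ := by gcongr
  refine h4.trans ?_
  calc 2 * (2 ^ p * (m * A) + (2 ^ (p + 1) * (m * μ)) ^ (p + 1))
      = (2 ^ (p + 1)) ^ 1 * (m * A) + 2 * (2 ^ (p + 1)) ^ (p + 1) * (m * μ) ^ (p + 1) := by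
        rw [mul_pow (2 ^ (p + 1))]; ring
    _ ≤ (2 ^ (p + 1)) ^ (p + 2) * (m * A) + (2 ^ (p + 1)) ^ (p + 2) * (m * μ) ^ (p + 1) := by
        have h1 : (1 : ℝ≥0∞) ≤ 2 ^ (p + 1) := one_le_pow₀ (by norm_num)
        gcongr
        · omega
        · rw [pow_succ (2 ^ (p + 1) : ℝ≥0∞) (p + 1), mul_comm]
          gcongr
          calc (2 : ℝ≥0∞) = 2 ^ 1 := by ring
            _ ≤ 2 ^ (p + 1) := by gcongr <;> norm_num
    _ = _ := by ring

/-- A sum of nonnegative numbers is large only if one term is large, or two terms are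
moderately large, or the sum of the small terms is moderately large. -/
theorem sum_le_of_one_jump (X : ℕ → ℝ≥0∞) {a b k : ℝ≥0∞} (m : ℕ)
    (h1 : ∀ i ∈ Finset.range m, X i ≤ a)
    (h2 : ∀ i ∈ Finset.range m, ∀ j ∈ Finset.range m, i ≠ j → X i ≤ k ∨ X j ≤ k)
    (h3 : ∑ i ∈ Finset.range m, (if X i ≤ k then X i else 0) ≤ b) :
    ∑ i ∈ Finset.range m, X i ≤ a + b := by
  by_cases h : ∃ i ∈ Finset.range m, ¬ X i ≤ k
  · obtain ⟨i, hi, hik⟩ := h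
    rw [← Finset.add_sum_erase _ _ hi]
    refine add_le_add (h1 i hi) (le_trans ?_ h3)
    rw [← Finset.add_sum_erase _ (fun i => if X i ≤ k then X i else 0) hi]
    refine le_add_left (Finset.sum_le_sum fun j hj => ?_)
    have := h2 i hi j (Finset.mem_of_mem_erase hj) (Finset.ne_of_mem_erase hj).symm
    rw [if_pos (this.resolve_left hik)]
  · push Not at h
    refine le_add_left (le_trans (Finset.sum_le_sum fun j hj => ?_) h3)
    rw [if_pos (h j hj)]

/-- Tail bound for a sum of independent nonnegative random variables. -/
theorem measure_sum_gt_le {Ω : Type*} [MeasurableSpace Ω] {P : Measure Ω}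
    [IsProbabilityMeasure P] {X : ℕ → Ω → ℝ≥0∞} (hm : ∀ i, Measurable (X i))
    (hind : ∀ i (s : Finset ℕ), i ∉ s → ∀ f : ℝ≥0∞ → ℝ≥0∞, Measurable f →
      IndepFun (X i) (fun ω => ∑ j ∈ s, f (X j ω)) P)
    {a b k p₁ q₁ q₂ A μ : ℝ≥0∞} (p : ℕ) (hk : k ≠ ∞) (hb : b ≠ 0) (hb' : b ≠ ∞)
    (hp₁ : ∀ i, P {ω | a < X i ω} ≤ p₁) (hq₁ : ∀ i, P {ω | k < X i ω} ≤ q₁)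
    (hq₂ : ∀ i, P {ω | k < X i ω} ≤ q₂)
    (hA : ∀ i, ∫⁻ ω, min (X i ω) k ^ (p + 1) ∂P ≤ A) (hμ : ∀ i, ∫⁻ ω, X i ω ∂P ≤ μ) (m : ℕ) :
    P {ω | a + b < ∑ i ∈ Finset.range m, X i ω} ≤ m * p₁ + q₁ * min (m : ℝ≥0∞) (m ^ 2 * q₂)
      + (2 ^ (p + 1)) ^ (p + 2) / b ^ (p + 1) * (m * A + (m * μ) ^ (p + 1)) := by
  set f : ℝ≥0∞ → ℝ≥0∞ := fun x => if x ≤ k then x else 0 with hf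
  have hfm : Measurable f := Measurable.ite measurableSet_Iic measurable_id measurable_const
  set E1 : Set Ω := ⋃ i ∈ Finset.range m, {ω | a < X i ω} with hE1
  set E2 : Set Ω := {ω | ∃ i ∈ Finset.range m, ∃ j ∈ Finset.range m, i ≠ j ∧
    k < X i ω ∧ k < X j ω} with hE2
  set E3 : Set Ω := {ω | b ≤ ∑ i ∈ Finset.range m, f (X i ω)} with hE3
  have hsub : {ω | a + b < ∑ i ∈ Finset.range m, X i ω} ⊆ E1 ∪ E2 ∪ E3 := by
    intro ω hω
    by_contra hcon
    simp only [Set.mem_union, not_or] at hcon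
    obtain ⟨⟨c1, c2⟩, c3⟩ := hcon
    refine absurd hω (not_lt.2 (sum_le_of_one_jump (fun i => X i ω) (k := k) m ?_ ?_ ?_))
    · intro i hi
      by_contra hc
      exact c1 (Set.mem_biUnion hi (not_le.1 hc))
    · intro i hi j hj hij
      by_contra hc
      rw [not_or, not_le, not_le] at hc
      exact c2 ⟨i, hi, j, hj, hij, hc⟩
    · exact (not_le.1 c3).le
  have b1 : P E1 ≤ m * p₁ := by
    calc P E1 ≤ ∑ i ∈ Finset.range m, P {ω | a < X i ω} := measure_biUnion_finset_le _ _
      _ ≤ ∑ _i ∈ Finset.range m, p₁ := Finset.sum_le_sum fun i _ => hp₁ i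
      _ = _ := by simp
  -- Both bounds are kept: the quadratic one gains `q₂`, while the linear one keeps the expression
  -- integrable when `m` is replaced by a variable with only a first moment.
  have b2 : P E2 ≤ q₁ * min (m : ℝ≥0∞) (m ^ 2 * q₂) := by
    have c1 : P E2 ≤ q₁ * m := by
      calc P E2 ≤ P (⋃ i ∈ Finset.range m, {ω | k < X i ω}) := by
            refine measure_mono ?_
            rintro ω ⟨i, hi, j, hj, hij, h1, h2⟩
            exact Set.mem_biUnion hi h1
        _ ≤ ∑ i ∈ Finset.range m, P {ω | k < X i ω} := measure_biUnion_finset_le _ _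
        _ ≤ ∑ _i ∈ Finset.range m, q₁ := Finset.sum_le_sum fun i _ => hq₁ i
        _ = _ := by simp [mul_comm]
    have c2 : P E2 ≤ q₁ * (m ^ 2 * q₂) := by
      calc P E2 ≤ P (⋃ i ∈ Finset.range m, ⋃ j ∈ (Finset.range m).erase i,
              {ω | k < X i ω} ∩ {ω | k < X j ω}) := by
            refine measure_mono ?_
            rintro ω ⟨i, hi, j, hj, hij, h1, h2⟩
            exact Set.mem_biUnion hi (Set.mem_biUnion (Finset.mem_erase.2 ⟨hij.symm, hj⟩) ⟨h1, h2⟩)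
        _ ≤ ∑ i ∈ Finset.range m, P (⋃ j ∈ (Finset.range m).erase i,
              {ω | k < X i ω} ∩ {ω | k < X j ω}) := measure_biUnion_finset_le _ _
        _ ≤ ∑ i ∈ Finset.range m, ∑ j ∈ (Finset.range m).erase i,
              P ({ω | k < X i ω} ∩ {ω | k < X j ω}) :=
            Finset.sum_le_sum fun i _ => measure_biUnion_finset_le _ _
        _ ≤ ∑ i ∈ Finset.range m, ∑ j ∈ (Finset.range m).erase i, q₁ * q₂ := by
            refine Finset.sum_le_sum fun i _ => Finset.sum_le_sum fun j hj => ?_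
            have hij := hind i {j} (by simpa using (Finset.ne_of_mem_erase hj).symm) id measurable_id
            simp only [Finset.sum_singleton, id] at hij
            have := hij.measure_inter_preimage_eq_mul _ _ (measurableSet_Ioi (a := k))
              (measurableSet_Ioi (a := k))
            refine (le_of_eq this).trans ?_
            exact mul_le_mul' (hq₁ i) (hq₂ j)
        _ ≤ ∑ i ∈ Finset.range m, ∑ _j ∈ Finset.range m, q₁ * q₂ :=
            Finset.sum_le_sum fun i _ =>
              Finset.sum_le_sum_of_subset (Finset.erase_subset _ _)
        _ = _ := by simp; ring
    rw [mul_min]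
    exact le_min c1 c2
  have b3 : P E3 ≤ (2 ^ (p + 1)) ^ (p + 2) / b ^ (p + 1) * (m * A + (m * μ) ^ (p + 1)) := by
    have hR := lintegral_sum_pow_le (P := P) (Y := fun i ω => f (X i ω))
      (fun i => hfm.comp (hm i))
      (fun i s his => (hind i s his f hfm).comp (φ := f) (ψ := id) hfm measurable_id) hk
      (fun i ω => by
        simp only [hf]; split_ifs with h
        · exact h
        · simp) p (A := A) (μ := μ)
      (fun i => by
        refine (lintegral_mono fun ω => ?_).trans (hA i)
        simp only [hf]; split_ifs with h
        · rw [min_eq_left h]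
        · simp)
      (fun i => by
        refine (lintegral_mono fun ω => ?_).trans (hμ i)
        simp only [hf]; split_ifs with h
        · exact le_rfl
        · simp) m
    have hsm : Measurable fun ω => ∑ i ∈ Finset.range m, f (X i ω) :=
      Finset.measurable_sum _ fun i _ => hfm.comp (hm i)
    calc P E3 ≤ P {ω | b ^ (p + 1) ≤ (∑ i ∈ Finset.range m, f (X i ω)) ^ (p + 1)} := by
          refine measure_mono fun ω hω => ?_
          exact pow_le_pow_left' (show b ≤ _ from hω) _
      _ ≤ (∫⁻ ω, (∑ i ∈ Finset.range m, f (X i ω)) ^ (p + 1) ∂P) / b ^ (p + 1) :=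
          meas_ge_le_lintegral_div (by fun_prop) (by simp [hb]) (by finiteness)
      _ ≤ ((2 ^ (p + 1)) ^ (p + 2) * (m * A + (m * μ) ^ (p + 1))) / b ^ (p + 1) := by
          gcongr
      _ = _ := by rw [div_eq_mul_inv, div_eq_mul_inv]; ring
  calc _ ≤ P (E1 ∪ E2 ∪ E3) := measure_mono hsub
    _ ≤ P E1 + P E2 + P E3 :=
      (measure_union_le _ _).trans (add_le_add_left (measure_union_le _ _) _)
    _ ≤ _ := by gcongr

/-! ### Sums with a random number of terms. -/

theorem lintegral_comp_nat {Ω : Type*} [MeasurableSpace Ω] {P : Measure Ω} {N : Ω → ℕ}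
    (hN : Measurable N) (φ : ℕ → ℝ≥0∞) :
    ∫⁻ ω, φ (N ω) ∂P = ∑' m, φ m * P {ω | N ω = m} := by
  rw [← lintegral_map (f := φ) (Measurable.of_discrete) hN, lintegral_countable']
  congr 1 with m
  rw [Measure.map_apply hN (measurableSet_singleton m)]
  rfl

/-- Wald's inequality: write the sum as ∑ 1{i < N} X_i and use independence of N from each X_i
separately. -/
theorem lintegral_sum_random_le {Ω : Type*} [MeasurableSpace Ω] {P : Measure Ω}
    {N : Ω → ℕ} (hN : Measurable N) {X : ℕ → Ω → ℝ≥0∞} (hX : ∀ i, Measurable (X i))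
    (hind : ∀ i, IndepFun N (X i) P) {μ : ℝ≥0∞} (hμ : ∀ i, ∫⁻ ω, X i ω ∂P ≤ μ) :
    ∫⁻ ω, ∑ i ∈ Finset.range (N ω), X i ω ∂P ≤ (∫⁻ ω, (N ω : ℝ≥0∞) ∂P) * μ := by
  have h1 : ∀ ω, ∑ i ∈ Finset.range (N ω), X i ω
      = ∑' i, (Set.Ioi i).indicator 1 (N ω) * X i ω := fun ω => by
    rw [tsum_eq_sum (s := Finset.range (N ω))]
    · refine Finset.sum_congr rfl fun i hi => ?_
      simp [Finset.mem_range.1 hi]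
    · intro i hi
      simp at hi
      simp [hi]
  have h2 : ∀ ω, (N ω : ℝ≥0∞) = ∑' i, (Set.Ioi i).indicator 1 (N ω) := fun ω => by
    rw [tsum_eq_sum (s := Finset.range (N ω))]
    · rw [Finset.sum_congr rfl (g := fun _ => (1 : ℝ≥0∞))]
      · simp
      · intro i hi
        simp [Finset.mem_range.1 hi]
    · intro i hi
      simp at hi
      simp [hi]
  have hmi : ∀ i : ℕ, Measurable fun ω => ((Set.Ioi i).indicator 1 (N ω) : ℝ≥0∞) := fun i =>
    (Measurable.of_discrete (f := fun n : ℕ => ((Set.Ioi i).indicator 1 n : ℝ≥0∞))).comp hN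
  simp_rw [h1, h2]
  rw [lintegral_tsum (f := fun i ω => (Set.Ioi i).indicator 1 (N ω) * X i ω)
      fun i => ((hmi i).mul (hX i)).aemeasurable,
    lintegral_tsum fun i => (hmi i).aemeasurable, ← ENNReal.tsum_mul_right]
  refine ENNReal.tsum_le_tsum fun i => ?_
  have : IndepFun (fun ω => ((Set.Ioi i).indicator 1 (N ω) : ℝ≥0∞)) (X i) P :=
    (hind i).comp (φ := fun n : ℕ => ((Set.Ioi i).indicator 1 n : ℝ≥0∞)) (ψ := id)
      Measurable.of_discrete measurable_id
  rw [lintegral_mul_eq_lintegral_mul_lintegral_of_indepFun'' (hmi i).aemeasurable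
    (hX i).aemeasurable this]
  gcongr
  exact hμ i

/-- Tail bound for a random sum of independent nonnegative random variables. -/
theorem measure_sum_random_gt_le {Ω : Type*} [MeasurableSpace Ω] {P : Measure Ω}
    [IsProbabilityMeasure P] {N : Ω → ℕ} (hN : Measurable N)
    {X : ℕ → Ω → ℝ≥0∞} (hm : ∀ i, Measurable (X i))
    (hind : ∀ i (s : Finset ℕ), i ∉ s → ∀ f : ℝ≥0∞ → ℝ≥0∞, Measurable f →
      IndepFun (X i) (fun ω => ∑ j ∈ s, f (X j ω)) P)
    (hindN : ∀ m, IndepFun N (fun ω => ∑ i ∈ Finset.range m, X i ω) P)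
    {a b k p₁ q₁ q₂ A μ M : ℝ≥0∞} (p : ℕ) (hk : k ≠ ∞) (hb : b ≠ 0) (hb' : b ≠ ∞)
    (hp₁ : ∀ i, P {ω | a < X i ω} ≤ p₁) (hq₁ : ∀ i, P {ω | k < X i ω} ≤ q₁)
    (hq₂ : ∀ i, P {ω | k < X i ω} ≤ q₂)
    (hA : ∀ i, ∫⁻ ω, min (X i ω) k ^ (p + 1) ∂P ≤ A) (hμ : ∀ i, ∫⁻ ω, X i ω ∂P ≤ μ) :
    P {ω | a + b < ∑ i ∈ Finset.range (N ω), X i ω} ≤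
      P {ω | M < N ω} + (∫⁻ ω, (N ω : ℝ≥0∞) ∂P) * p₁
      + q₁ * ∫⁻ ω, min (N ω : ℝ≥0∞) (N ω ^ 2 * q₂) ∂P
      + (2 ^ (p + 1)) ^ (p + 2) / b ^ (p + 1) * ((∫⁻ ω, (N ω : ℝ≥0∞) ∂P) * A
        + μ ^ (p + 1) * ∫⁻ ω, min (N ω : ℝ≥0∞) M ^ (p + 1) ∂P) := by
  set D : ℝ≥0∞ := (2 ^ (p + 1)) ^ (p + 2) / b ^ (p + 1) with hD
  set φ : ℕ → ℝ≥0∞ := fun m => {m : ℕ | M < m}.indicator 1 m + m * p₁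
    + q₁ * min (m : ℝ≥0∞) (m ^ 2 * q₂) + D * (m * A + μ ^ (p + 1) * min (m : ℝ≥0∞) M ^ (p + 1))
    with hφ
  have h1 : ∀ m : ℕ, P {ω | a + b < ∑ i ∈ Finset.range m, X i ω} ≤ φ m := by
    intro m
    -- Above `M` the trivial bound 1 is used, so that only the truncated moment of N enters, the
    -- full one of order p + 1 possibly being infinite.
    by_cases hmM : M < m
    · refine prob_le_one.trans ?_
      simp only [hφ]
      rw [Set.indicator_of_mem (show m ∈ {m : ℕ | M < m} from hmM), add_assoc, add_assoc]
      exact le_self_add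
    · refine (measure_sum_gt_le hm hind p hk hb hb' hp₁ hq₁ hq₂ hA hμ m).trans ?_
      simp only [hφ]
      rw [Set.indicator_of_notMem (show m ∉ {m : ℕ | M < m} from hmM),
        min_eq_left (not_lt.1 hmM), mul_pow, mul_comm (μ ^ (p + 1)), zero_add]
  have hcast : Measurable fun ω => (N ω : ℝ≥0∞) :=
    (Measurable.of_discrete (f := fun n : ℕ => (n : ℝ≥0∞))).comp hN
  have hMset : MeasurableSet {ω | M < N ω} := measurableSet_lt measurable_const hcast
  calc P {ω | a + b < ∑ i ∈ Finset.range (N ω), X i ω}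
      ≤ ∑' m, P ({ω | N ω = m} ∩ {ω | a + b < ∑ i ∈ Finset.range m, X i ω}) := by
        refine (measure_mono ?_).trans (measure_iUnion_le _)
        intro ω hω
        exact Set.mem_iUnion.2 ⟨N ω, rfl, hω⟩
    _ = ∑' m, P {ω | a + b < ∑ i ∈ Finset.range m, X i ω} * P {ω | N ω = m} := by
        congr 1 with m
        rw [mul_comm]
        exact (hindN m).measure_inter_preimage_eq_mul _ _ (measurableSet_singleton m)
          (measurableSet_Ioi (a := a + b))
    _ ≤ ∑' m, φ m * P {ω | N ω = m} := ENNReal.tsum_le_tsum fun m => by gcongr; exact h1 m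
    _ = ∫⁻ ω, φ (N ω) ∂P := (lintegral_comp_nat hN φ).symm
    _ = _ := by
        have e1 : ∀ ω, ({m : ℕ | M < m}.indicator 1 (N ω) : ℝ≥0∞)
            = {ω | M < N ω}.indicator 1 ω := fun ω => rfl
        simp only [hφ, e1]
        rw [lintegral_add_left, lintegral_add_left, lintegral_add_left, lintegral_indicator_one hMset,
          lintegral_mul_const _ hcast, lintegral_const_mul, lintegral_const_mul, lintegral_add_left,
          lintegral_mul_const _ hcast, lintegral_const_mul]
        all_goals fun_prop

/-! ### Moments obtained from tail bounds. -/

theorem lintegral_rpow_Ioc {r z : ℝ} (hr : -1 < r) (hz : 0 < z) :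
    ∫⁻ t in Set.Ioc 0 z, ENNReal.ofReal (t ^ r) = ENNReal.ofReal (z ^ (r + 1) / (r + 1)) := by
  have hi := (intervalIntegral.intervalIntegrable_rpow' (a := 0) (b := z) hr)
  rw [intervalIntegrable_iff_integrableOn_Ioc_of_le hz.le] at hi
  rw [← ofReal_integral_eq_lintegral_ofReal hi]
  · rw [← intervalIntegral.integral_of_le hz.le, integral_rpow (Or.inl hr),
      Real.zero_rpow (by linarith), sub_zero]
  · filter_upwards [ae_restrict_mem measurableSet_Ioc] with t ht
    exact Real.rpow_nonneg ht.1.le _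

/-- A truncated moment, estimated through a power bound for the tail. -/
theorem lintegral_min_pow_le {Ω : Type*} [MeasurableSpace Ω] {P : Measure Ω}
    {Z : Ω → ℝ≥0∞} (hZ : Measurable Z) {z a H : ℝ} (hz : 0 < z) (hH : 0 ≤ H) (p : ℕ)
    (hap : a < p + 1)
    (htail : ∀ y, 0 < y → y < z → P {ω | ENNReal.ofReal y < Z ω}
      ≤ ENNReal.ofReal (H * (z / y) ^ a)) :
    ∫⁻ ω, min (Z ω) (ENNReal.ofReal z) ^ (p + 1) ∂P
      ≤ ENNReal.ofReal ((p + 1) / (p + 1 - a) * H * z ^ (p + 1)) := by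
  set V : Ω → ℝ := fun ω => (min (Z ω) (ENNReal.ofReal z)).toReal with hV
  have hfin : ∀ ω, min (Z ω) (ENNReal.ofReal z) ≠ ∞ := fun ω =>
    ne_top_of_le_ne_top ENNReal.ofReal_ne_top (min_le_right _ _)
  have hVm : Measurable V := (hZ.min measurable_const).ennreal_toReal
  have e1 : ∀ ω, min (Z ω) (ENNReal.ofReal z) ^ (p + 1) = ENNReal.ofReal (V ω ^ ((p : ℝ) + 1)) := by
    intro ω
    have : ((p : ℝ) + 1) = ((p + 1 : ℕ) : ℝ) := by push_cast; ring
    rw [this, Real.rpow_natCast, ENNReal.ofReal_pow ENNReal.toReal_nonneg,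
      ENNReal.ofReal_toReal (hfin ω)]
  simp_rw [e1]
  rw [lintegral_rpow_eq_lintegral_meas_lt_mul P (ae_of_all _ fun ω => ENNReal.toReal_nonneg)
    hVm.aemeasurable (by positivity : (0 : ℝ) < p + 1)]
  have e2 : ∀ t ∈ Set.Ioi (0 : ℝ), P {ω | t < V ω} * ENNReal.ofReal (t ^ ((p : ℝ) + 1 - 1))
      ≤ (Set.Ioc 0 z).indicator
        (fun t => ENNReal.ofReal (H * z ^ a) * ENNReal.ofReal (t ^ ((p : ℝ) - a))) t := by
    intro t ht
    have ht0 : 0 < t := ht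
    rcases lt_or_ge t z with htz | htz
    · rw [Set.indicator_of_mem (show t ∈ Set.Ioc 0 z from ⟨ht0, htz.le⟩)]
      calc P {ω | t < V ω} * ENNReal.ofReal (t ^ ((p : ℝ) + 1 - 1))
          ≤ ENNReal.ofReal (H * (z / t) ^ a) * ENNReal.ofReal (t ^ ((p : ℝ) + 1 - 1)) := by
            gcongr
            refine (measure_mono fun ω hω => ?_).trans (htail t ht0 htz)
            have h1 := (ENNReal.ofReal_lt_iff_lt_toReal ht0.le (hfin ω)).2 hω
            exact h1.trans_le (min_le_left _ _)
        _ = _ := by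
            rw [← ENNReal.ofReal_mul (by positivity), ← ENNReal.ofReal_mul (by positivity)]
            congr 1
            rw [Real.div_rpow hz.le ht0.le, show (p : ℝ) + 1 - 1 = p by ring, Real.rpow_sub ht0]
            ring
    · have : {ω | t < V ω} = ∅ := by
        ext ω
        simp only [Set.mem_ofPred_eq, Set.mem_empty_iff_false, iff_false, not_lt]
        refine le_trans ?_ htz
        exact ENNReal.toReal_le_of_le_ofReal hz.le (min_le_right _ _)
      rw [this]; simp
  have hpa : 0 < (p : ℝ) + 1 - a := by linarith
  calc ENNReal.ofReal (p + 1) * ∫⁻ t in Set.Ioi 0,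
        P {ω | t < V ω} * ENNReal.ofReal (t ^ ((p : ℝ) + 1 - 1))
      ≤ ENNReal.ofReal (p + 1) * ∫⁻ t in Set.Ioi 0, (Set.Ioc 0 z).indicator
        (fun t => ENNReal.ofReal (H * z ^ a) * ENNReal.ofReal (t ^ ((p : ℝ) - a))) t := by
        refine mul_le_mul_right ?_ _
        exact setLIntegral_mono' measurableSet_Ioi e2
    _ ≤ ENNReal.ofReal (p + 1) * ∫⁻ t, (Set.Ioc 0 z).indicator
        (fun t => ENNReal.ofReal (H * z ^ a) * ENNReal.ofReal (t ^ ((p : ℝ) - a))) t := by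
        refine mul_le_mul_right ?_ _
        exact setLIntegral_le_lintegral _ _
    _ = ENNReal.ofReal (p + 1) * (ENNReal.ofReal (H * z ^ a) *
          ENNReal.ofReal (z ^ ((p : ℝ) - a + 1) / ((p : ℝ) - a + 1))) := by
        rw [lintegral_indicator measurableSet_Ioc, lintegral_const_mul _ (by fun_prop),
          lintegral_rpow_Ioc (by linarith) hz]
    _ = _ := by
        rw [← ENNReal.ofReal_mul (by positivity), ← ENNReal.ofReal_mul (by positivity)]
        congr 1
        have : z ^ a * z ^ ((p : ℝ) - a + 1) = z ^ (p + 1) := by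
          rw [← Real.rpow_add hz, ← Real.rpow_natCast]; congr 1; push_cast; ring
        rw [← this, show (p : ℝ) - a + 1 = p + 1 - a by ring]
        ring

/-- Truncated moments of random variables whose tail is dominated by a regularly varying one. -/
theorem RegularTail.lintegral_min_pow_le {T : ℝ → ℝ} {α a : ℝ} (hT : RegularTail T α)
    (ha : α < a) (ha1 : 1 ≤ a) (p : ℕ) (hap : a < p + 1) :
    ∃ B : ℝ, 0 < B ∧ ∀ {Ω : Type*} [MeasurableSpace Ω] {P : Measure Ω}
      {Z : Ω → ℝ≥0∞} (_ : Measurable Z) {D D' : ℝ} (_ : 0 ≤ D) (_ : 0 ≤ D')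
      (_ : ∀ y, 1 ≤ y → P {ω | ENNReal.ofReal y < Z ω} ≤ ENNReal.ofReal (D * T y))
      (_ : ∫⁻ ω, Z ω ∂P ≤ ENNReal.ofReal D') {z : ℝ} (_ : 1 ≤ z),
      ∫⁻ ω, min (Z ω) (ENNReal.ofReal z) ^ (p + 1) ∂P
        ≤ ENNReal.ofReal (B * (D + D') * (z ^ (p + 1) * T z)) := by
  obtain ⟨A, hA, hpot⟩ := hT.potter_lower (by linarith) ha
  have hT1 := hT.pos 1 one_pos
  have hpa : 0 < (p : ℝ) + 1 - a := by linarith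
  refine ⟨(p + 1) / (p + 1 - a) * (A + A / T 1), by positivity, ?_⟩
  intro Ω _ P Z hZ D D' hD hD' htail hmean z hz
  have hz0 : 0 < z := by linarith
  have hTz := hT.pos z hz0
  refine (WeightedBranching.lintegral_min_pow_le hZ hz0
    (H := (A + A / T 1) * (D + D') * T z) (by positivity) p hap ?_).trans (le_of_eq ?_)
  · intro y hy hyz
    rcases le_total 1 y with h1 | h1
    · refine (htail y h1).trans (ENNReal.ofReal_le_ofReal ?_)
      calc D * T y ≤ D * (A * (z / y) ^ a * T z) := by
            gcongr; exact hpot y z h1 hyz.le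
        _ = A * D * T z * (z / y) ^ a := by ring
        _ ≤ (A + A / T 1) * (D + D') * T z * (z / y) ^ a := by
            gcongr
            · have : 0 < A / T 1 := by positivity
              linarith
            · linarith
    · have h2 : P {ω | ENNReal.ofReal y < Z ω} ≤ ENNReal.ofReal (D' / y) := by
        calc P {ω | ENNReal.ofReal y < Z ω} ≤ P {ω | ENNReal.ofReal y ≤ Z ω} :=
              measure_mono fun ω hω => by simpa using le_of_lt (by simpa using hω)
          _ ≤ (∫⁻ ω, Z ω ∂P) / ENNReal.ofReal y :=
              meas_ge_le_lintegral_div hZ.aemeasurable (by simpa using hy) (by simp)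
          _ ≤ ENNReal.ofReal D' / ENNReal.ofReal y := by gcongr
          _ = _ := (ENNReal.ofReal_div_of_pos hy).symm
      refine h2.trans (ENNReal.ofReal_le_ofReal ?_)
      have h3 : 1 ≤ A / T 1 * z ^ a * T z := by
        have := hpot 1 z le_rfl hz
        rw [div_one] at this
        rw [div_mul_eq_mul_div, div_mul_eq_mul_div, one_le_div hT1]
        exact this
      have h4 : 1 / y ≤ (1 / y) ^ a := by
        conv_lhs => rw [← Real.rpow_one (1 / y)]
        exact Real.rpow_le_rpow_of_exponent_le ((one_le_div hy).2 h1) ha1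
      calc D' / y = D' * (1 * (1 / y)) := by ring
        _ ≤ D' * ((A / T 1 * z ^ a * T z) * (1 / y) ^ a) := by gcongr
        _ = (A / T 1) * D' * T z * (z / y) ^ a := by
            rw [div_eq_mul_one_div z y, Real.mul_rpow hz0.le (by positivity)]; ring
        _ ≤ (A + A / T 1) * (D + D') * T z * (z / y) ^ a := by
            gcongr
            · linarith
            · linarith
  · congr 1; ring

/-- Potter's bound with an exponent strictly between 1 and `α` makes the tail integrable. -/
theorem RegularTail.lintegral_lt_top {T : ℝ → ℝ} {α : ℝ} (hT : RegularTail T α) (hα : 1 < α)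
    {Ω : Type*} [MeasurableSpace Ω] {P : Measure Ω} [IsProbabilityMeasure P]
    {V : Ω → ℝ} (hV : Measurable V) (hV0 : ∀ ω, 0 ≤ V ω)
    (htail : ∀ y, 1 ≤ y → P {ω | y < V ω} ≤ ENNReal.ofReal (T y)) :
    ∫⁻ ω, ENNReal.ofReal (V ω) ∂P < ∞ := by
  obtain ⟨b, hb1, hb⟩ := exists_between hα
  obtain ⟨A, hA, hpot⟩ := hT.potter_upper (by linarith) hb
  rw [lintegral_eq_lintegral_meas_lt P (ae_of_all _ hV0) hV.aemeasurable,
    ← Set.Ioc_union_Ioi_eq_Ioi (zero_le_one' ℝ)]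
  refine (lintegral_union_le _ _ _).trans_lt (ENNReal.add_lt_top.2 ⟨?_, ?_⟩)
  · calc ∫⁻ t in Set.Ioc 0 1, P {ω | t < V ω} ≤ ∫⁻ _ in Set.Ioc (0 : ℝ) 1, 1 :=
          lintegral_mono fun t => prob_le_one
      _ < ∞ := by simp
  · have hint := (integrableOn_Ioi_rpow_of_lt (neg_lt_neg hb1) one_pos).const_mul (A * T 1)
    refine lt_of_le_of_lt (setLIntegral_mono' measurableSet_Ioi fun t ht => ?_)
      hint.lintegral_lt_top
    have ht1 : (1 : ℝ) < t := ht
    refine (htail t ht1.le).trans (ENNReal.ofReal_le_ofReal ((hpot 1 t le_rfl ht1.le).trans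
      (le_of_eq ?_)))
    rw [Real.rpow_neg (by linarith), one_div, Real.inv_rpow (by linarith)]
    ring

/-- Dominated convergence with dominating function `Z`: integrability of `Z ^ 2` is not needed. This
supplies the small factor for two simultaneous big jumps. -/
theorem exists_lintegral_min_sq_le {Ω : Type*} [MeasurableSpace Ω] {P : Measure Ω}
    {Z : Ω → ℝ≥0∞} (hZ : Measurable Z) (hfin : ∫⁻ ω, Z ω ∂P ≠ ∞) {ε : ℝ≥0∞} (hε : 0 < ε) :
    ∃ q₀ : ℝ≥0∞, 0 < q₀ ∧ ∀ q ≤ q₀, ∫⁻ ω, min (Z ω) (Z ω ^ 2 * q) ∂P ≤ ε := by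
  have h := tendsto_lintegral_filter_of_dominated_convergence (μ := P) (l := 𝓝 (0 : ℝ≥0∞))
    (F := fun q ω => min (Z ω) (Z ω ^ 2 * q)) (f := fun _ => 0) Z
    (Eventually.of_forall fun q => by fun_prop)
    (Eventually.of_forall fun q => ae_of_all _ fun ω => min_le_left _ _) hfin (by
      filter_upwards [ae_lt_top hZ hfin] with ω hω
      have h1 : Tendsto (fun q : ℝ≥0∞ => Z ω ^ 2 * q) (𝓝 0) (𝓝 (Z ω ^ 2 * 0)) :=
        ENNReal.Tendsto.const_mul tendsto_id (Or.inr (by finiteness))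
      have h2 := (tendsto_const_nhds (x := Z ω)).min h1
      simpa using h2)
  simp only [lintegral_zero] at h
  obtain ⟨q₀, hq₀, hq⟩ := (ENNReal.nhds_zero_basis_Iic.eventually_iff).1 (h.eventually_le_const hε)
  exact ⟨q₀, hq₀, fun q hq' => hq hq'⟩

/-! ### Breiman-type bounds for products. -/

/-- Domination of `T (y / c) / T y` by a power of `c`. -/
theorem RegularTail.ratio_le {T : ℝ → ℝ} {α a A : ℝ} (hT : RegularTail T α)
    (hpot : ∀ y z, 1 ≤ y → y ≤ z → T y ≤ A * (z / y) ^ a * T z) (hA : 0 < A) {y c : ℝ}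
    (hy : 1 ≤ y) (hc : 0 < c) (hcy : c ≤ y) : T (y / c) / T y ≤ 1 + A * c ^ a := by
  have hTy := hT.pos y (by linarith)
  have hca : 0 < A * c ^ a := by positivity
  rw [div_le_iff₀ hTy]
  rcases le_total c 1 with h | h
  · have h1 : T (y / c) ≤ T y := hT.anti (by rw [le_div_iff₀ hc]; nlinarith)
    nlinarith
  · have h1 := hpot (y / c) y ((one_le_div hc).2 hcy) (div_le_self (by linarith) h)
    rw [div_div_cancel₀ (by linarith)] at h1
    nlinarith

/-- Condition on `c`. If `c ≤ y`, the tail bound applies at `y / c ≥ 1`; if `c > y`, Markov gives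
`D' * (c / y)`, which is at most `D' * (c / y) ^ s` since `s ≥ 1`. -/
theorem measure_mul_gt_le {T : ℝ → ℝ} {s : ℝ} (hTpos : ∀ x, 0 < x → 0 < T x)
    (hs : 1 ≤ s) {Ω : Type*} [MeasurableSpace Ω] {P : Measure Ω}
    [IsProbabilityMeasure P] {c : Ω → ℝ} {w : Ω → ℝ≥0∞} (hc : Measurable c) (hw : Measurable w)
    (hind : IndepFun c w P) {D D' : ℝ} (hD : 0 ≤ D) (hD' : 0 ≤ D')
    (htail : ∀ y, 1 ≤ y → P {ω | ENNReal.ofReal y < w ω} ≤ ENNReal.ofReal (D * T y))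
    (hmean : ∫⁻ ω, w ω ∂P ≤ ENNReal.ofReal D') {y : ℝ} (hy : 1 ≤ y) :
    P {ω | ENNReal.ofReal y < ENNReal.ofReal (c ω) * w ω} ≤
      ENNReal.ofReal (D * T y) * (∫⁻ ω, (Set.Ioc 0 y).indicator
        (fun c => ENNReal.ofReal (T (y / c) / T y)) (c ω) ∂P)
      + ENNReal.ofReal (D' * y ^ (-s)) * ∫⁻ ω, ENNReal.ofReal (c ω ^ s) ∂P := by
  have hy0 : 0 < y := by linarith
  have hTy := hTpos y hy0
  have hmap := (indepFun_iff_map_prod_eq_prod_map_map hc.aemeasurable hw.aemeasurable).1 hind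
  set E : Set (ℝ × ℝ≥0∞) := {z | ENNReal.ofReal y < ENNReal.ofReal z.1 * z.2} with hE
  have hEm : MeasurableSet E := measurableSet_lt measurable_const (by fun_prop)
  have : IsProbabilityMeasure (P.map w) := Measure.isProbabilityMeasure_map hw.aemeasurable
  have h1 : P {ω | ENNReal.ofReal y < ENNReal.ofReal (c ω) * w ω}
      = ∫⁻ ω, P {ω' | ENNReal.ofReal y < ENNReal.ofReal (c ω) * w ω'} ∂P := by
    calc P {ω | ENNReal.ofReal y < ENNReal.ofReal (c ω) * w ω}
        = (P.map fun ω => (c ω, w ω)) E := (Measure.map_apply (hc.prodMk hw) hEm).symm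
      _ = ∫⁻ r, P.map w (Prod.mk r ⁻¹' E) ∂(P.map c) := by
          rw [hmap, Measure.prod_apply hEm]
      _ = ∫⁻ ω, P.map w (Prod.mk (c ω) ⁻¹' E) ∂P :=
          lintegral_map (measurable_measure_prodMk_left hEm) hc
      _ = _ := by
          refine lintegral_congr fun ω => ?_
          rw [Measure.map_apply hw (measurable_prodMk_left hEm)]
          rfl
  rw [h1]
  refine (lintegral_mono (g := fun ω => ENNReal.ofReal (D * T y) * (Set.Ioc 0 y).indicator
        (fun c => ENNReal.ofReal (T (y / c) / T y)) (c ω)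
      + ENNReal.ofReal (D' * y ^ (-s)) * ENNReal.ofReal (c ω ^ s)) fun ω => ?_).trans ?_
  · simp only
    rcases le_or_gt (c ω) 0 with h0 | h0
    · simp [ENNReal.ofReal_of_nonpos h0]
    have h2 : {ω' | ENNReal.ofReal y < ENNReal.ofReal (c ω) * w ω'}
        ⊆ {ω' | ENNReal.ofReal (y / c ω) < w ω'} := by
      intro ω' hω'
      simp only [Set.mem_ofPred_eq] at hω' ⊢
      rw [ENNReal.ofReal_div_of_pos h0]
      exact ENNReal.div_lt_of_lt_mul' hω'
    refine (measure_mono h2).trans ?_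
    rcases le_or_gt (c ω) y with hcy | hcy
    · rw [Set.indicator_of_mem (show c ω ∈ Set.Ioc 0 y from ⟨h0, hcy⟩)]
      refine le_add_right ?_
      rw [← ENNReal.ofReal_mul (by positivity)]
      refine (htail _ ((one_le_div h0).2 hcy)).trans (le_of_eq ?_)
      congr 1
      field_simp
    · refine le_add_left ?_
      calc P {ω' | ENNReal.ofReal (y / c ω) < w ω'}
          ≤ P {ω' | ENNReal.ofReal (y / c ω) ≤ w ω'} := measure_mono fun ω hω => by simpa using le_of_lt (by simpa using hω)
        _ ≤ (∫⁻ ω, w ω ∂P) / ENNReal.ofReal (y / c ω) :=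
            meas_ge_le_lintegral_div hw.aemeasurable (by simp; positivity) (by simp)
        _ ≤ ENNReal.ofReal D' / ENNReal.ofReal (y / c ω) := by gcongr
        _ = ENNReal.ofReal (D' / (y / c ω)) := (ENNReal.ofReal_div_of_pos (by positivity)).symm
        _ ≤ ENNReal.ofReal (D' * y ^ (-s) * c ω ^ s) := by
            refine ENNReal.ofReal_le_ofReal ?_
            have h3 : c ω / y ≤ (c ω / y) ^ s := by
              conv_lhs => rw [← Real.rpow_one (c ω / y)]
              exact Real.rpow_le_rpow_of_exponent_le ((one_le_div hy0).2 hcy.le) hs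
            calc D' / (y / c ω) = D' * (c ω / y) := by field_simp
              _ ≤ D' * (c ω / y) ^ s := by gcongr
              _ = _ := by
                rw [Real.div_rpow h0.le hy0.le, Real.rpow_neg hy0.le]; ring
        _ = _ := ENNReal.ofReal_mul (by positivity)
  · rw [lintegral_add_right _ (by fun_prop), lintegral_const_mul' _ _ (by finiteness),
      lintegral_const_mul' _ _ (by finiteness)]

/-- Tail of a product of a random variable with more than `α` moments and one whose tail is
dominated by a regularly varying tail of index `-α`. -/
theorem RegularTail.measure_mul_gt_le {T : ℝ → ℝ} {α s : ℝ} (hT : RegularTail T α) (hα : 0 < α)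
    (hαs : α < s) (hs : 1 ≤ s) {Ω : Type*} [MeasurableSpace Ω] {P : Measure Ω}
    [IsProbabilityMeasure P] {C : Ω → ℝ} (hC : Measurable C) (hC0 : ∀ᵐ ω ∂P, 0 ≤ C ω)
    (hmom : Integrable (fun ω => C ω ^ s) P) :
    ∃ B : ℝ, 0 < B ∧
      (∀ {c : Ω → ℝ} {w : Ω → ℝ≥0∞} (_ : IdentDistrib c C P P) (_ : Measurable c)
        (_ : Measurable w) (_ : IndepFun c w P)
        {D D' : ℝ} (_ : 0 ≤ D) (_ : 0 ≤ D')
        (_ : ∀ y, 1 ≤ y → P {ω | ENNReal.ofReal y < w ω} ≤ ENNReal.ofReal (D * T y))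
        (_ : ∫⁻ ω, w ω ∂P ≤ ENNReal.ofReal D') (y : ℝ) (_ : 1 ≤ y),
        P {ω | ENNReal.ofReal y < ENNReal.ofReal (c ω) * w ω}
          ≤ ENNReal.ofReal ((D + D') * B * T y)) ∧
      ∀ h : ℝ, ∫ ω, C ω ^ α ∂P < h → ∃ y₀ : ℝ, 1 ≤ y₀ ∧
        ∀ {c : Ω → ℝ} {w : Ω → ℝ≥0∞} (_ : IdentDistrib c C P P) (_ : Measurable c)
          (_ : Measurable w) (_ : IndepFun c w P)
          {D D' : ℝ} (_ : 0 ≤ D) (_ : 0 ≤ D')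
          (_ : ∀ y, 1 ≤ y → P {ω | ENNReal.ofReal y < w ω} ≤ ENNReal.ofReal (D * T y))
          (_ : ∫⁻ ω, w ω ∂P ≤ ENNReal.ofReal D') (y : ℝ) (_ : y₀ ≤ y),
          P {ω | ENNReal.ofReal y < ENNReal.ofReal (c ω) * w ω}
            ≤ ENNReal.ofReal ((D * h + D' * B) * T y) := by
  obtain ⟨A, hA, hpot⟩ := hT.potter_lower (by linarith) hαs
  have hT1 := hT.pos 1 one_pos
  have hTm : Measurable T := hT.anti.measurable
  set F : ℝ → ℝ → ℝ≥0∞ := fun y => (Set.Ioc 0 y).indicator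
    (fun c => ENNReal.ofReal (T (y / c) / T y)) with hF
  have hFm : ∀ y, Measurable (F y) := fun y =>
    Measurable.indicator (by fun_prop) measurableSet_Ioc
  have hFle : ∀ y, 1 ≤ y → ∀ c, F y c ≤ ENNReal.ofReal (1 + A * c ^ s) := by
    intro y hy c
    by_cases hcy : c ∈ Set.Ioc 0 y
    · simp only [hF]
      rw [Set.indicator_of_mem hcy]
      exact ENNReal.ofReal_le_ofReal (hT.ratio_le hpot hA hy hcy.1 hcy.2)
    · simp only [hF]
      rw [Set.indicator_of_notMem hcy]
      exact zero_le
  have hint : Integrable (fun ω => 1 + A * C ω ^ s) P :=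
    (integrable_const _).add (hmom.const_mul A)
  have hint_fin : ∫⁻ ω, ENNReal.ofReal (1 + A * C ω ^ s) ∂P ≠ ∞ := hint.lintegral_lt_top.ne
  set I : ℝ := ∫ ω, C ω ^ s ∂P with hI
  have hI0 : 0 ≤ I := integral_nonneg_of_ae (by
    filter_upwards [hC0] with ω hω
    exact Real.rpow_nonneg hω _)
  have hIeq : ∫⁻ ω, ENNReal.ofReal (C ω ^ s) ∂P = ENNReal.ofReal I :=
    (ofReal_integral_eq_lintegral_ofReal hmom (by
      filter_upwards [hC0] with ω hω
      exact Real.rpow_nonneg hω _)).symm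
  set J : ℝ := (∫⁻ ω, ENNReal.ofReal (1 + A * C ω ^ s) ∂P).toReal with hJ
  have hJ0 : 0 ≤ J := ENNReal.toReal_nonneg
  have hpow : ∀ y, 1 ≤ y → y ^ (-s) ≤ A / T 1 * T y := by
    intro y hy
    have hy0 : 0 < y := by linarith
    have := hpot 1 y le_rfl hy
    rw [div_one] at this
    rw [Real.rpow_neg hy0.le, inv_le_iff_one_le_mul₀ (by positivity), div_mul_eq_mul_div,
      div_mul_eq_mul_div, one_le_div hT1]
    linarith
  -- `J` bounds the expected tail ratio uniformly in `y ≥ 1`, and `A / T 1 * I` pays for the event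
  -- `c > y` once `y ^ (-s)` is compared with `T y`.
  set B : ℝ := J + 1 + A / T 1 * I with hB
  have hAI : 0 ≤ A / T 1 * I := by positivity
  have main : ∀ {c : Ω → ℝ} {w : Ω → ℝ≥0∞} (_ : IdentDistrib c C P P) (_ : Measurable c)
        (_ : Measurable w) (_ : IndepFun c w P)
        {D D' : ℝ} (_ : 0 ≤ D) (_ : 0 ≤ D')
        (_ : ∀ y, 1 ≤ y → P {ω | ENNReal.ofReal y < w ω} ≤ ENNReal.ofReal (D * T y))
        (_ : ∫⁻ ω, w ω ∂P ≤ ENNReal.ofReal D') (y : ℝ) (_ : 1 ≤ y) (h : ℝ) (_ : 0 ≤ h)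
        (_ : ∫⁻ ω, F y (C ω) ∂P ≤ ENNReal.ofReal h),
        P {ω | ENNReal.ofReal y < ENNReal.ofReal (c ω) * w ω}
          ≤ ENNReal.ofReal ((D * h + D' * B) * T y) := by
    intro c w hid hc hw hind D D' hD hD' htail hmean y hy h hh hFh
    have hTy := hT.pos y (by linarith)
    have hyp : 0 < y ^ (-s) := Real.rpow_pos_of_pos (by linarith) _
    have e1 : ∫⁻ ω, F y (c ω) ∂P = ∫⁻ ω, F y (C ω) ∂P :=
      (hid.comp (hFm y)).lintegral_eq
    have e2 : ∫⁻ ω, ENNReal.ofReal (c ω ^ s) ∂P = ∫⁻ ω, ENNReal.ofReal (C ω ^ s) ∂P :=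
      (hid.comp (u := fun x : ℝ => ENNReal.ofReal (x ^ s)) (by fun_prop)).lintegral_eq
    refine (WeightedBranching.measure_mul_gt_le hT.pos hs hc hw hind hD hD' htail hmean hy).trans ?_
    rw [e2, hIeq]
    change ENNReal.ofReal (D * T y) * ∫⁻ ω, F y (c ω) ∂P + _ ≤ _
    rw [e1]
    calc _ ≤ ENNReal.ofReal (D * T y) * ENNReal.ofReal h
          + ENNReal.ofReal (D' * y ^ (-s)) * ENNReal.ofReal I := by gcongr
      _ = ENNReal.ofReal (D * T y * h + D' * y ^ (-s) * I) := by
          rw [← ENNReal.ofReal_mul (by positivity), ← ENNReal.ofReal_mul (by positivity),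
            ← ENNReal.ofReal_add (by positivity) (by positivity)]
      _ ≤ _ := by
          refine ENNReal.ofReal_le_ofReal ?_
          have h1 : D' * y ^ (-s) * I ≤ D' * (A / T 1 * T y) * I := by
            gcongr; exact hpow y hy
          have h2 : D' * (A / T 1 * T y) * I ≤ D' * B * T y := by
            calc D' * (A / T 1 * T y) * I = D' * (A / T 1 * I) * T y := by ring
              _ ≤ _ := by gcongr; linarith
          linarith
  refine ⟨B, by positivity, ?_, ?_⟩
  · intro c w hid hc hw hind D D' hD hD' htail hmean y hy
    have hTy := hT.pos y (by linarith)
    refine (main hid hc hw hind hD hD' htail hmean y hy J hJ0 ?_).trans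
      (ENNReal.ofReal_le_ofReal ?_)
    · rw [hJ, ENNReal.ofReal_toReal hint_fin]
      exact lintegral_mono fun ω => hFle y hy _
    · gcongr
      have : D * J ≤ D * B := by gcongr; linarith
      linarith
  · intro h hh
    have hCα : Integrable (fun ω => C ω ^ α) P := by
      refine Integrable.mono' ((integrable_const (1 : ℝ)).add hmom)
        (hC.pow_const α).aestronglyMeasurable ?_
      filter_upwards [hC0] with ω hω
      rw [Real.norm_of_nonneg (Real.rpow_nonneg hω _)]
      simp only [Pi.add_apply]
      rcases le_total (C ω) 1 with h1 | h1
      · have := Real.rpow_le_one hω h1 hα.le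
        have := Real.rpow_nonneg hω s
        linarith
      · have := Real.rpow_le_rpow_of_exponent_le h1 hαs.le
        linarith
    have hCα0 : 0 ≤ᵐ[P] fun ω => C ω ^ α := by
      filter_upwards [hC0] with ω hω
      exact Real.rpow_nonneg hω _
    have hh0 : 0 < h := (integral_nonneg_of_ae hCα0).trans_lt hh
    -- Regular variation gives T(y/C)/T(y) → C^α pointwise, and Potter supplies the integrable
    -- majorant 1 + A C^s. The resulting threshold depends neither on `w` nor on `D`, `D'`.
    have hlim := tendsto_lintegral_filter_of_dominated_convergence (μ := P) (l := atTop)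
      (F := fun y ω => F y (C ω)) (f := fun ω => ENNReal.ofReal (C ω ^ α))
      (fun ω => ENNReal.ofReal (1 + A * C ω ^ s))
      (Eventually.of_forall fun y => (hFm y).comp hC)
      (by
        filter_upwards [eventually_ge_atTop 1] with y hy
        exact ae_of_all _ fun ω => hFle y hy _) hint_fin (by
      filter_upwards [hC0] with ω hω
      rcases hω.eq_or_lt with h0 | h0
      · rw [← h0, Real.zero_rpow hα.ne']
        simp [hF]
      · have h1 := hT.lim (C ω)⁻¹ (by positivity)
        rw [Real.inv_rpow h0.le, Real.rpow_neg h0.le, inv_inv] at h1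
        refine (ENNReal.tendsto_ofReal h1).congr' ?_
        filter_upwards [eventually_ge_atTop (C ω)] with y hy
        simp only [hF]
        rw [Set.indicator_of_mem (show C ω ∈ Set.Ioc 0 y from ⟨h0, hy⟩), inv_mul_eq_div])
    rw [← ofReal_integral_eq_lintegral_ofReal hCα hCα0] at hlim
    obtain ⟨y₀, hy₀⟩ := eventually_atTop.1
      (hlim.eventually_le_const ((ENNReal.ofReal_lt_ofReal_iff hh0).2 hh))
    refine ⟨max y₀ 1, le_max_right _ _, ?_⟩
    intro c w hid hc hw hind D D' hD hD' htail hmean y hy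
    exact main hid hc hw hind hD hD' htail hmean y (le_trans (le_max_right _ _) hy) h hh0.le
      (hy₀ y (le_trans (le_max_left _ _) hy))

/-! ### Decomposition of the tree at the root. -/

theorem mem_generation_succ (N : List ℕ → ℕ) (n : ℕ) (v : List ℕ) :
    v ∈ generation N (n + 1) ↔ ∃ u ∈ generation N n, ∃ i < N u, u ++ [i] = v := by
  simp [generation]

/-- The definition extends lists at the end, whereas the recursion over subtrees needs them extended
at the front. -/
theorem mem_generation_succ' (N : List ℕ → ℕ) (n : ℕ) (v : List ℕ) :
    v ∈ generation N (n + 1) ↔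
      ∃ i < N [], ∃ u ∈ generation (fun u => N (i :: u)) n, i :: u = v := by
  induction n generalizing v with
  | zero => simp [generation]
  | succ n ih =>
    rw [mem_generation_succ]
    constructor
    · rintro ⟨u', hu', j, hj, rfl⟩
      obtain ⟨i, hi, u, hu, rfl⟩ := (ih u').1 hu'
      exact ⟨i, hi, u ++ [j], (mem_generation_succ _ _ _).2 ⟨u, hu, j, hj, rfl⟩, rfl⟩
    · rintro ⟨i, hi, u', hu', rfl⟩
      obtain ⟨u, hu, j, hj, rfl⟩ := (mem_generation_succ _ _ _).1 hu'
      exact ⟨i :: u, (ih _).2 ⟨i, hi, u, hu, rfl⟩, j, hj, rfl⟩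

theorem generation_succ' (N : List ℕ → ℕ) (n : ℕ) :
    generation N (n + 1) = (Finset.range (N [])).biUnion fun i =>
      (generation (fun u => N (i :: u)) n).image (List.cons i) := by
  ext v
  rw [mem_generation_succ']
  simp

theorem branchWeight_cons (C : List ℕ → ℝ) (i : ℕ) (v : List ℕ) :
    branchWeight C (i :: v) = C [i] * branchWeight (fun u => C (i :: u)) v := by
  simp [branchWeight, Finset.prod_range_succ', mul_comm]

theorem totalWeight_succ (N : List ℕ → ℕ) (C Q : List ℕ → ℝ) (n : ℕ) :
    totalWeight N C Q (n + 1) = ∑ i ∈ Finset.range (N []), C [i] *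
      totalWeight (fun u => N (i :: u)) (fun u => C (i :: u)) (fun u => Q (i :: u)) n := by
  rw [totalWeight, generation_succ', Finset.sum_biUnion]
  · refine Finset.sum_congr rfl fun i _ => ?_
    rw [Finset.sum_image (List.cons_injective.injOn), totalWeight, Finset.mul_sum]
    refine Finset.sum_congr rfl fun v _ => ?_
    rw [branchWeight_cons]
    ring
  · intro i _ j _ hij
    rw [Function.onFun, Finset.disjoint_left]
    intro v hv hv'
    obtain ⟨u, -, rfl⟩ := Finset.mem_image.1 hv
    obtain ⟨u', -, h⟩ := Finset.mem_image.1 hv'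
    exact hij (List.cons.inj h).1.symm

/-- The weight of the `n`-th generation as an extended nonnegative number, computed by
recursion over the subtrees of the root. -/
noncomputable def recWeight :
    ℕ → (List ℕ → ℕ) → (List ℕ → ℝ) → (List ℕ → ℝ) → ℝ≥0∞
  | 0, _, _, Q => ENNReal.ofReal (Q [])
  | n + 1, N, C, Q => ∑ i ∈ Finset.range (N []), ENNReal.ofReal (C [i]) *
      recWeight n (fun u => N (i :: u)) (fun u => C (i :: u)) (fun u => Q (i :: u))

theorem totalWeight_nonneg {C Q : List ℕ → ℝ} (hC : ∀ v, 0 ≤ C v) (hQ : ∀ v, 0 ≤ Q v)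
    (N : List ℕ → ℕ) (n : ℕ) : 0 ≤ totalWeight N C Q n :=
  Finset.sum_nonneg fun v _ => mul_nonneg (hQ v) (Finset.prod_nonneg fun _ _ => hC _)

theorem ofReal_totalWeight (n : ℕ) : ∀ {C Q : List ℕ → ℝ} (_ : ∀ v, 0 ≤ C v)
    (_ : ∀ v, 0 ≤ Q v) (N : List ℕ → ℕ),
    ENNReal.ofReal (totalWeight N C Q n) = recWeight n N C Q := by
  induction n with
  | zero => intro C Q _ _ N; simp [totalWeight, recWeight, generation, branchWeight]
  | succ n ih =>
    intro C Q hC hQ N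
    rw [totalWeight_succ, recWeight, ENNReal.ofReal_sum_of_nonneg]
    · refine Finset.sum_congr rfl fun i _ => ?_
      rw [ENNReal.ofReal_mul (hC _), ih (fun v => hC _) (fun v => hQ _)]
    · exact fun i _ => mul_nonneg (hC _) (totalWeight_nonneg (fun v => hC _) (fun v => hQ _) _ _)

theorem measurable_sum_range {Ω : Type*} [MeasurableSpace Ω] {N : Ω → ℕ} (hN : Measurable N)
    {X : ℕ → Ω → ℝ≥0∞} (hX : ∀ i, Measurable (X i)) :
    Measurable fun ω => ∑ i ∈ Finset.range (N ω), X i ω := by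
  have h : Measurable fun z : ℕ × Ω => ∑ i ∈ Finset.range z.1, X i z.2 :=
    measurable_from_prod_countable_right fun m =>
      Finset.measurable_sum (Finset.range m) fun i _ => hX i
  exact h.comp (hN.prodMk measurable_id)

/-- The weight never involves the factor at the root, so nothing is asked of `Ct []`; this yields
independence of a child's factor from the weight of its subtree. -/
theorem measurable_recWeight {Ω : Type*} [MeasurableSpace Ω] (n : ℕ) :
    ∀ {Nt : List ℕ → Ω → ℕ} {Ct Qt : List ℕ → Ω → ℝ} (_ : ∀ v, Measurable (Nt v))
      (_ : ∀ v, v ≠ [] → Measurable (Ct v)) (_ : ∀ v, Measurable (Qt v)),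
    Measurable fun ω => recWeight n (fun v => Nt v ω) (fun v => Ct v ω) (fun v => Qt v ω) := by
  induction n with
  | zero => intro Nt Ct Qt _ _ hQ; exact (hQ []).ennreal_ofReal
  | succ n ih =>
    intro Nt Ct Qt hN hC hQ
    simp only [recWeight]
    refine measurable_sum_range (hN []) fun i => ?_
    exact (hC [i] (by simp)).ennreal_ofReal.mul
      (ih (fun v => hN _) (fun v _ => hC _ (by simp)) (fun v => hQ _))

/-! ### Independence of branches and means of generations. -/

/-- The σ-algebra generated by the members of a family whose indices lie in `S`. -/
@[reducible] def blockSigma {Ω ι : Type*} (f : ι → Ω → ℝ) (S : Set ι) : MeasurableSpace Ω :=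
  ⨆ k ∈ S, MeasurableSpace.comap (f k) inferInstance

theorem measurable_blockSigma {Ω ι : Type*} (f : ι → Ω → ℝ) {S : Set ι} {k : ι} (hk : k ∈ S) :
    Measurable[blockSigma f S] (f k) := by
  rw [measurable_iff_comap_le]
  exact le_iSup₂_of_le k hk le_rfl

/-- All independence statements below reduce to this one: exhibit disjoint index sets on which the
two functions depend. -/
theorem indepFun_of_blockSigma {Ω ι β γ : Type*} [MeasurableSpace Ω] {P : Measure Ω}
    [MeasurableSpace β] [MeasurableSpace γ] {f : ι → Ω → ℝ} (hf : iIndepFun f P)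
    (hm : ∀ k, Measurable (f k)) {S T : Set ι} (hST : Disjoint S T) {g : Ω → β} {h : Ω → γ}
    (hg : Measurable[blockSigma f S] g) (hh : Measurable[blockSigma f T] h) : IndepFun g h P := by
  have h1 : Indep (blockSigma f S) (blockSigma f T) P :=
    indep_iSup_of_disjoint (fun k => (hm k).comap_le) hf hST
  rw [IndepFun_iff_Indep]
  exact indep_of_indep_of_le_right (indep_of_indep_of_le_left h1 hg.comap_le) hh.comap_le

namespace IsIIDTree

section Blocks

variable {Ω : Type*} {Nt : List ℕ → Ω → ℕ} {Ct Qt : List ℕ → Ω → ℝ}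

/-- The individual to which the variable with the given index is attached. -/
def owner : List ℕ ⊕ (List ℕ ⊕ List ℕ) → List ℕ := Sum.elim id (Sum.elim id id)

/-- The whole family of random variables attached to the tree. -/
def family (Nt : List ℕ → Ω → ℕ) (Ct Qt : List ℕ → Ω → ℝ) :
    List ℕ ⊕ (List ℕ ⊕ List ℕ) → Ω → ℝ :=
  Sum.elim (fun v ω => (Nt v ω : ℝ)) (Sum.elim Ct Qt)

theorem measurable_blockSigma_N {S : Set (List ℕ ⊕ (List ℕ ⊕ List ℕ))} {v : List ℕ}
    (hv : Sum.inl v ∈ S) : Measurable[blockSigma (family Nt Ct Qt) S] (Nt v) := by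
  have h1 := measurable_blockSigma (family Nt Ct Qt) hv
  have h2 : Nt v = fun ω => ⌊family Nt Ct Qt (Sum.inl v) ω⌋₊ := by
    funext ω
    simp [family]
  rw [h2]
  exact Nat.measurable_floor.comp h1

theorem measurable_blockSigma_C {S : Set (List ℕ ⊕ (List ℕ ⊕ List ℕ))} {v : List ℕ}
    (hv : Sum.inr (Sum.inl v) ∈ S) : Measurable[blockSigma (family Nt Ct Qt) S] (Ct v) :=
  measurable_blockSigma (family Nt Ct Qt) hv

theorem measurable_blockSigma_Q {S : Set (List ℕ ⊕ (List ℕ ⊕ List ℕ))} {v : List ℕ}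
    (hv : Sum.inr (Sum.inr v) ∈ S) : Measurable[blockSigma (family Nt Ct Qt) S] (Qt v) :=
  measurable_blockSigma (family Nt Ct Qt) hv

theorem measurable_blockSigma_recWeight {S : Set (List ℕ ⊕ (List ℕ ⊕ List ℕ))} (n i : ℕ)
    (hN : ∀ v, Sum.inl (i :: v) ∈ S) (hC : ∀ v, v ≠ [] → Sum.inr (Sum.inl (i :: v)) ∈ S)
    (hQ : ∀ v, Sum.inr (Sum.inr (i :: v)) ∈ S) :
    Measurable[blockSigma (family Nt Ct Qt) S] fun ω =>
      recWeight n (fun v => Nt (i :: v) ω) (fun v => Ct (i :: v) ω) (fun v => Qt (i :: v) ω) :=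
  let _ := blockSigma (family Nt Ct Qt) S
  measurable_recWeight n (fun v => measurable_blockSigma_N (hN v))
    (fun v hv => measurable_blockSigma_C (hC v hv)) (fun v => measurable_blockSigma_Q (hQ v))

/-- The contribution of the `i`-th child of the root to generation `n + 1`. -/
noncomputable def branch (Nt : List ℕ → Ω → ℕ) (Ct Qt : List ℕ → Ω → ℝ) (n i : ℕ) (ω : Ω) : ℝ≥0∞ :=
  ENNReal.ofReal (Ct [i] ω) *
    recWeight n (fun v => Nt (i :: v) ω) (fun v => Ct (i :: v) ω) (fun v => Qt (i :: v) ω)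

theorem measurable_blockSigma_branch {S : Set (List ℕ ⊕ (List ℕ ⊕ List ℕ))} (n i : ℕ)
    (hS : ∀ k v, owner k = i :: v → k ∈ S) :
    Measurable[blockSigma (family Nt Ct Qt) S] (branch Nt Ct Qt n i) :=
  let _ := blockSigma (family Nt Ct Qt) S
  (measurable_blockSigma_C (hS _ [] rfl)).ennreal_ofReal.mul
    (measurable_blockSigma_recWeight n i (fun v => hS _ v rfl) (fun v _ => hS _ v rfl)
      (fun v => hS _ v rfl))

end Blocks

variable {Ω : Type*} [MeasurableSpace Ω] {P : Measure Ω} {N : Ω → ℕ} {C Q : Ω → ℝ}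
  {Nt : List ℕ → Ω → ℕ} {Ct Qt : List ℕ → Ω → ℝ}

theorem subtree (h : IsIIDTree P N C Q Nt Ct Qt) (i : ℕ) :
    IsIIDTree P N C Q (fun v => Nt (i :: v)) (fun v => Ct (i :: v)) (fun v => Qt (i :: v)) where
  measurable_N v := h.measurable_N _
  measurable_C v := h.measurable_C _
  measurable_Q v := h.measurable_Q _
  identDistrib_N v := h.identDistrib_N _
  identDistrib_C v := h.identDistrib_C _
  identDistrib_Q v := h.identDistrib_Q _
  indep := by
    have h1 := h.indep.precomp (g := Sum.map (List.cons i) (Sum.map (List.cons i) (List.cons i)))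
      (List.cons_injective.sumMap (List.cons_injective.sumMap List.cons_injective))
    convert h1 using 1
    funext k
    rcases k with k | k | k <;> rfl

theorem measurable_family (h : IsIIDTree P N C Q Nt Ct Qt) (k : List ℕ ⊕ (List ℕ ⊕ List ℕ)) :
    Measurable (family Nt Ct Qt k) := by
  rcases k with v | v | v
  · exact (Measurable.of_discrete (f := fun n : ℕ => (n : ℝ))).comp (h.measurable_N v)
  · exact h.measurable_C v
  · exact h.measurable_Q v

theorem measurable_weight (h : IsIIDTree P N C Q Nt Ct Qt) (n : ℕ) :
    Measurable fun ω => recWeight n (fun v => Nt v ω) (fun v => Ct v ω) (fun v => Qt v ω) :=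
  measurable_recWeight n h.measurable_N (fun v _ => h.measurable_C v) h.measurable_Q

theorem measurable_branch (h : IsIIDTree P N C Q Nt Ct Qt) (n i : ℕ) :
    Measurable (branch Nt Ct Qt n i) :=
  (h.measurable_C _).ennreal_ofReal.mul ((h.subtree i).measurable_weight n)

theorem indepFun_branch_sum (h : IsIIDTree P N C Q Nt Ct Qt) (n i : ℕ) (s : Finset ℕ)
    (his : i ∉ s) (f : ℝ≥0∞ → ℝ≥0∞) (hf : Measurable f) :
    IndepFun (branch Nt Ct Qt n i) (fun ω => ∑ j ∈ s, f (branch Nt Ct Qt n j ω)) P := by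
  refine indepFun_of_blockSigma (f := family Nt Ct Qt) h.indep h.measurable_family
    (S := {k | ∃ v, owner k = i :: v}) (T := {k | ∃ j ∈ s, ∃ v, owner k = j :: v}) ?_
    (measurable_blockSigma_branch n i fun k v hk => ⟨v, hk⟩) ?_
  · rw [Set.disjoint_left]
    rintro k ⟨v, hv⟩ ⟨j, hj, u, hu⟩
    rw [hv] at hu
    exact his ((List.cons.inj hu).1 ▸ hj)
  · let _ := blockSigma (family Nt Ct Qt) {k | ∃ j ∈ s, ∃ v, owner k = j :: v}
    exact Finset.measurable_sum _ fun j hj =>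
      hf.comp (measurable_blockSigma_branch n j fun k v hk => ⟨j, hj, v, hk⟩)

theorem indepFun_root_sum (h : IsIIDTree P N C Q Nt Ct Qt) (n : ℕ) (s : Finset ℕ) :
    IndepFun (Nt []) (fun ω => ∑ j ∈ s, branch Nt Ct Qt n j ω) P := by
  refine indepFun_of_blockSigma (f := family Nt Ct Qt) h.indep h.measurable_family
    (S := {k | owner k = []}) (T := {k | ∃ j, ∃ v, owner k = j :: v}) ?_
    (measurable_blockSigma_N rfl) ?_
  · rw [Set.disjoint_left]
    rintro k hk ⟨j, u, hu⟩
    rw [Set.mem_ofPred_eq] at hk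
    rw [hk] at hu
    exact absurd hu (by simp)
  · let _ := blockSigma (family Nt Ct Qt) {k | ∃ j, ∃ v, owner k = j :: v}
    exact Finset.measurable_sum _ fun j _ =>
      measurable_blockSigma_branch n j fun k v hk => ⟨j, v, hk⟩

theorem indepFun_factor_weight (h : IsIIDTree P N C Q Nt Ct Qt) (n i : ℕ) :
    IndepFun (Ct [i]) (fun ω => recWeight n (fun v => Nt (i :: v) ω) (fun v => Ct (i :: v) ω)
      (fun v => Qt (i :: v) ω)) P := by
  refine indepFun_of_blockSigma (f := family Nt Ct Qt) h.indep h.measurable_family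
    (S := {Sum.inr (Sum.inl [i])}) (T := {Sum.inr (Sum.inl [i])}ᶜ) disjoint_compl_right
    (measurable_blockSigma_C rfl) (measurable_blockSigma_recWeight n i ?_ ?_ ?_)
  · simp
  · simp
  · simp

theorem lintegral_branch (h : IsIIDTree P N C Q Nt Ct Qt) (n i : ℕ) :
    ∫⁻ ω, branch Nt Ct Qt n i ω ∂P = (∫⁻ ω, ENNReal.ofReal (C ω) ∂P) *
      ∫⁻ ω, recWeight n (fun v => Nt (i :: v) ω) (fun v => Ct (i :: v) ω)
        (fun v => Qt (i :: v) ω) ∂P := by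
  have h1 : IndepFun (fun ω => ENNReal.ofReal (Ct [i] ω)) _ P :=
    (h.indepFun_factor_weight n i).comp ENNReal.measurable_ofReal measurable_id
  have h2 := lintegral_mul_eq_lintegral_mul_lintegral_of_indepFun''
    (h.measurable_C [i]).ennreal_ofReal.aemeasurable
    ((h.subtree i).measurable_weight n).aemeasurable h1
  refine h2.trans ?_
  congr 1
  exact ((h.identDistrib_C [i]).comp ENNReal.measurable_ofReal).lintegral_eq

theorem lintegral_weight_le (n : ℕ) : ∀ {Nt : List ℕ → Ω → ℕ} {Ct Qt : List ℕ → Ω → ℝ}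
    (_ : IsIIDTree P N C Q Nt Ct Qt),
    ∫⁻ ω, recWeight n (fun v => Nt v ω) (fun v => Ct v ω) (fun v => Qt v ω) ∂P
      ≤ ((∫⁻ ω, (N ω : ℝ≥0∞) ∂P) * ∫⁻ ω, ENNReal.ofReal (C ω) ∂P) ^ n
        * ∫⁻ ω, ENNReal.ofReal (Q ω) ∂P := by
  induction n with
  | zero =>
    intro Nt Ct Qt h
    rw [pow_zero, one_mul]
    exact ((h.identDistrib_Q []).comp ENNReal.measurable_ofReal).lintegral_eq.le
  | succ n ih =>
    intro Nt Ct Qt h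
    have h1 : ∫⁻ ω, (Nt [] ω : ℝ≥0∞) ∂P = ∫⁻ ω, (N ω : ℝ≥0∞) ∂P :=
      ((h.identDistrib_N []).comp (u := fun n : ℕ => (n : ℝ≥0∞))
        Measurable.of_discrete).lintegral_eq
    refine (lintegral_sum_random_le (h.measurable_N []) (X := branch Nt Ct Qt n)
      (h.measurable_branch n) (μ := (∫⁻ ω, ENNReal.ofReal (C ω) ∂P) *
        (((∫⁻ ω, (N ω : ℝ≥0∞) ∂P) * ∫⁻ ω, ENNReal.ofReal (C ω) ∂P) ^ n
          * ∫⁻ ω, ENNReal.ofReal (Q ω) ∂P)) (fun i => ?_) (fun i => ?_)).trans (le_of_eq ?_)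
    · simpa using h.indepFun_root_sum n {i}
    · rw [h.lintegral_branch]
      gcongr
      exact ih (h.subtree i)
    · rw [h1]; ring

end IsIIDTree

/-! ### The induction step. -/

theorem exists_gt_mul_lt {a b c : ℝ} (h : a * b < c) : ∃ b' > b, a * b' < c := by
  have h1 : Tendsto (fun t => a * t) (𝓝[>] b) (𝓝 (a * b)) :=
    ((continuous_const_mul a).tendsto b).mono_left nhdsWithin_le_nhds
  obtain ⟨t, ht1, ht2⟩ := ((h1.eventually_lt_const h).and self_mem_nhdsWithin).exists
  exact ⟨t, ht2, ht1⟩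

theorem exists_lt_one_mul_rpow_lt {a c α : ℝ} (h : a < c) :
    ∃ l : ℝ, 0 < l ∧ l < 1 ∧ a * l ^ (-α) < c := by
  have h1 : Tendsto (fun t : ℝ => a * t ^ (-α)) (𝓝[<] 1) (𝓝 (a * 1 ^ (-α))) :=
    (((Real.continuousAt_rpow_const 1 (-α) (Or.inl one_ne_zero)).const_mul a).tendsto).mono_left
      nhdsWithin_le_nhds
  rw [Real.one_rpow, mul_one] at h1
  obtain ⟨t, ht1, ht2, ht3⟩ := ((h1.eventually_lt_const h).and
    ((eventually_nhdsWithin_of_eventually_nhds (lt_mem_nhds one_pos)).and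
      self_mem_nhdsWithin)).exists
  exact ⟨t, ht2, ht3, ht1⟩

theorem measure_gt_le_div {Ω : Type*} [MeasurableSpace Ω] {P : Measure Ω} {Z : Ω → ℝ≥0∞}
    (hZ : Measurable Z) {D y : ℝ} (hy : 0 < y) (hmean : ∫⁻ ω, Z ω ∂P ≤ ENNReal.ofReal D) :
    P {ω | ENNReal.ofReal y < Z ω} ≤ ENNReal.ofReal (D / y) := by
  calc P {ω | ENNReal.ofReal y < Z ω} ≤ P {ω | ENNReal.ofReal y ≤ Z ω} :=
        measure_mono fun ω hω => by simpa using le_of_lt (by simpa using hω)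
    _ ≤ (∫⁻ ω, Z ω ∂P) / ENNReal.ofReal y :=
        meas_ge_le_lintegral_div hZ.aemeasurable (by simpa using hy) (by simp)
    _ ≤ ENNReal.ofReal D / ENNReal.ofReal y := by gcongr
    _ = _ := (ENNReal.ofReal_div_of_pos hy).symm

namespace IsIIDTree

variable {Ω : Type*} [MeasurableSpace Ω] {P : Measure Ω} [IsProbabilityMeasure P]
  {N : Ω → ℕ} {C Q : Ω → ℝ}

set_option maxHeartbeats 1600000 in
/-- Passing from generation `n` to generation `n + 1` improves the constant of the tail bound by a
factor `θ < η`, up to an additive error and for large arguments. -/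
theorem exists_tail_succ {T : ℝ → ℝ} {α s η EN EC EQ : ℝ} (hT : RegularTail T α) (hα : 1 < α)
    (hαs : α < s) (hN : Measurable N) (hC : Measurable C) (hC0 : ∀ᵐ ω ∂P, 0 ≤ C ω)
    (hmom : Integrable (fun ω => C ω ^ s) P)
    (hNT : ∀ y, 0 < y → P {ω | ENNReal.ofReal y < (N ω : ℝ≥0∞)} = ENNReal.ofReal (T y))
    (hEN0 : 0 ≤ EN) (hEC0 : 0 ≤ EC) (hEQ0 : 0 ≤ EQ)
    (hEN : ∫⁻ ω, (N ω : ℝ≥0∞) ∂P = ENNReal.ofReal EN)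
    (hEC : ∫⁻ ω, ENNReal.ofReal (C ω) ∂P = ENNReal.ofReal EC)
    (hEQ : ∫⁻ ω, ENNReal.ofReal (Q ω) ∂P = ENNReal.ofReal EQ)
    (hη0 : 0 < η) (hη1 : η < 1) (hηC : EN * EC ≤ η) (hηα : EN * ∫ ω, C ω ^ α ∂P < η) :
    ∃ θ c x₀ : ℝ, θ < η ∧ 0 ≤ c ∧ 1 ≤ x₀ ∧ ∀ K : ℝ, 0 ≤ K → ∀ n : ℕ,
      ∀ {Nt : List ℕ → Ω → ℕ} {Ct Qt : List ℕ → Ω → ℝ} (_ : IsIIDTree P N C Q Nt Ct Qt)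
        (_ : ∀ i y, 1 ≤ y → P {ω | ENNReal.ofReal y < recWeight n (fun v => Nt (i :: v) ω)
          (fun v => Ct (i :: v) ω) (fun v => Qt (i :: v) ω)} ≤ ENNReal.ofReal (K * η ^ n * T y))
        (x : ℝ) (_ : x₀ ≤ x),
        P {ω | ENNReal.ofReal x < recWeight (n + 1) (fun v => Nt v ω)
          (fun v => Ct v ω) (fun v => Qt v ω)} ≤ ENNReal.ofReal ((θ * K + c) * η ^ n * T x) := by
  have hs1 : 1 < s := by linarith
  have hcast : Measurable fun ω => (N ω : ℝ≥0∞) :=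
    (Measurable.of_discrete (f := fun n : ℕ => (n : ℝ≥0∞))).comp hN
  have hm0 : 0 ≤ ∫ ω, C ω ^ α ∂P := integral_nonneg_of_ae (by
    filter_upwards [hC0] with ω hω
    exact Real.rpow_nonneg hω _)
  obtain ⟨h, hmh, hh⟩ := exists_gt_mul_lt hηα
  have hh0 : 0 < h := by linarith
  obtain ⟨l, hl0, hl1, hl⟩ := exists_lt_one_mul_rpow_lt (α := α) hh
  obtain ⟨r, hlr, hr⟩ := exists_gt_mul_lt hl
  have hr0 : 0 < r := (Real.rpow_pos_of_pos hl0 _).trans hlr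
  -- `g` is the room left below `η` by the main term. Two thirds of it are spent, on two big jumps
  -- and on the truncated moment; the last third keeps `θ < η`.
  obtain ⟨g, hg⟩ : ∃ t : ℝ, t = η - EN * h * r := ⟨_, rfl⟩
  have hg0 : 0 < g := by linarith
  obtain ⟨B, hB, hprod, hprod'⟩ := hT.measure_mul_gt_le (by linarith) hαs hs1.le hC hC0 hmom
  obtain ⟨y₀, hy₀, hprod'⟩ := hprod' h hmh
  -- With `p ≥ s` one has κ^(p+1) κ^(-s) ≤ κ, so truncation at κx gains a factor κ even after T(κx)
  -- is compared with T(x).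
  obtain ⟨p, hps⟩ : ∃ p : ℕ, s ≤ p := ⟨_, Nat.le_ceil s⟩
  obtain ⟨B₂, hB₂, hmoment⟩ := hT.lintegral_min_pow_le hαs hs1.le p (by linarith)
  obtain ⟨A₁, hA₁, hup⟩ := hT.potter_upper zero_le_one hα
  obtain ⟨A₂, hA₂, hlow⟩ := hT.potter_lower (by linarith) hαs
  obtain ⟨d, hd⟩ : ∃ t : ℝ, t = 1 - l := ⟨_, rfl⟩
  have hd0 : 0 < d := by linarith
  obtain ⟨cp, hcp⟩ : ∃ t : ℝ, t = (2 ^ (p + 1)) ^ (p + 2) / d ^ (p + 1) := ⟨_, rfl⟩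
  have hcp0 : 0 < cp := by rw [hcp]; positivity
  obtain ⟨G, hG⟩ : ∃ t : ℝ, t = cp * EN * B₂ * A₂ := ⟨_, rfl⟩
  have hG0 : 0 ≤ G := by rw [hG]; positivity
  obtain ⟨κ, hκ⟩ : ∃ t : ℝ, t = min 1 (g / (3 * (G * B + 1))) := ⟨_, rfl⟩
  have hκ0 : 0 < κ := hκ ▸ lt_min one_pos (by positivity)
  have hκ1 : κ ≤ 1 := hκ ▸ min_le_left _ _
  have hκG : G * B * κ ≤ g / 3 := by
    calc G * B * κ ≤ (G * B + 1) * (g / (3 * (G * B + 1))) := by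
          gcongr
          · linarith
          · exact hκ ▸ min_le_right _ _
      _ = g / 3 := by field_simp
  have hκs0 : 0 < κ ^ (-s) := Real.rpow_pos_of_pos hκ0 _
  have hκp : κ ^ (p + 1) * κ ^ (-s) ≤ κ := by
    rw [← Real.rpow_natCast, ← Real.rpow_add hκ0]
    conv_rhs => rw [← Real.rpow_one κ]
    refine Real.rpow_le_rpow_of_exponent_ge hκ0 hκ1 ?_
    push_cast
    linarith
  obtain ⟨ε, hε⟩ : ∃ t : ℝ, t = g / 3 / (B * A₂ * κ ^ (-s)) := ⟨_, rfl⟩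
  have hε0 : 0 < ε := by rw [hε]; positivity
  obtain ⟨q₀, hq₀, hq⟩ := exists_lintegral_min_sq_le (P := P) hcast
    (by rw [hEN]; exact ENNReal.ofReal_ne_top) (ENNReal.ofReal_pos.2 hε0)
  -- No condition involves K or n. For the two-jump term this is possible because one of the two
  -- probabilities is bounded through the mean, not through K.
  have hlarge : ∀ᶠ x in atTop, 1 ≤ x ∧ y₀ / l ≤ x ∧ 1 / κ ≤ x ∧ T (l * x) / T x < r ∧
      ENNReal.ofReal (EC * EQ / (κ * x)) ≤ q₀ := by
    refine (eventually_ge_atTop _).and ((eventually_ge_atTop _).and ((eventually_ge_atTop _).and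
      (((hT.lim l hl0).eventually_lt_const hlr).and ?_)))
    have h1 : Tendsto (fun x => EC * EQ / (κ * x)) atTop (𝓝 0) :=
      tendsto_const_nhds.div_atTop (tendsto_id.const_mul_atTop hκ0)
    have h2 := ENNReal.tendsto_ofReal h1
    rw [ENNReal.ofReal_zero] at h2
    exact h2.eventually_le_const hq₀
  obtain ⟨x₁, hx₁⟩ := eventually_atTop.1 hlarge
  set c : ℝ := A₁ + EN * EQ * B * r + EQ * (g / 3) + G * (EQ * B + EC * EQ)
    + cp * (EC * EQ) ^ (p + 1) * B₂ * (1 + EN) * A₁ with hc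
  have hc0 : 0 ≤ c := by positivity
  refine ⟨EN * h * r + g / 3 + g / 3, c, max x₁ 1, by linarith, hc0, le_max_right _ _, ?_⟩
  intro K hK n Nt Ct Qt htree htail x hx
  obtain ⟨hx1, hxl, hxκ, hxr, hxq⟩ := hx₁ x ((le_max_left _ _).trans hx)
  have hx0 : 0 < x := by linarith
  have hTx := hT.pos x hx0
  obtain ⟨u, hu⟩ : ∃ t : ℝ, t = η ^ n := ⟨_, rfl⟩
  rw [← hu]
  simp only [← hu] at htail
  have hu0 : 0 < u := by rw [hu]; positivity
  have hu1 : u ≤ 1 := hu ▸ pow_le_one₀ hη0.le hη1.le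
  have hlx : y₀ ≤ l * x := by rwa [div_le_iff₀' hl0] at hxl
  have hκx : 1 ≤ κ * x := by rwa [div_le_iff₀' hκ0] at hxκ
  have hTκ : T (κ * x) ≤ A₂ * κ ^ (-s) * T x := by
    refine (hlow (κ * x) x hκx (by nlinarith)).trans (le_of_eq ?_)
    rw [Real.rpow_neg hκ0.le, ← Real.inv_rpow hκ0.le]
    congr 3
    field_simp
  have hTl : T (l * x) ≤ r * T x := by
    rw [div_lt_iff₀ hTx] at hxr
    exact hxr.le
  have hTκ0 := hT.pos (κ * x) (by linarith)
  -- With M = x/u the factor u^(p+1) from the means cancels the power M^(p+1) up to x^(p+1), leaving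
  -- T(M), of order at most u T(x).
  obtain ⟨M, hM⟩ : ∃ t : ℝ, t = x / u := ⟨_, rfl⟩
  have hxM : x ≤ M := hM ▸ le_div_self hx0.le hu0 hu1
  have hM0 : 0 < M := by linarith
  have hTM0 := hT.pos M hM0
  have hTM : T M ≤ A₁ * u * T x := by
    refine (hup x M hx1 hxM).trans (le_of_eq ?_)
    rw [Real.rpow_one, hM, div_div_cancel₀ hx0.ne']
  have hmean : ∀ i, ∫⁻ ω, recWeight n (fun v => Nt (i :: v) ω) (fun v => Ct (i :: v) ω)
      (fun v => Qt (i :: v) ω) ∂P ≤ ENNReal.ofReal (EQ * u) := by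
    intro i
    refine (lintegral_weight_le n (htree.subtree i)).trans ?_
    rw [hEN, hEC, hEQ, ← ENNReal.ofReal_mul hEN0, ← ENNReal.ofReal_pow (by positivity),
      ← ENNReal.ofReal_mul (by positivity), mul_comm, hu]
    gcongr
  have hmeanX : ∀ i, ∫⁻ ω, branch Nt Ct Qt n i ω ∂P ≤ ENNReal.ofReal (EC * EQ * u) := by
    intro i
    rw [htree.lintegral_branch, hEC, mul_assoc, ENNReal.ofReal_mul hEC0]
    gcongr
    exact hmean i
  have hD : 0 ≤ K * u := by positivity
  have hD' : 0 ≤ EQ * u := by positivity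
  have hX : ∀ i y, 1 ≤ y → P {ω | ENNReal.ofReal y < branch Nt Ct Qt n i ω}
      ≤ ENNReal.ofReal ((K * u + EQ * u) * B * T y) := fun i y hy =>
    hprod (htree.identDistrib_C [i]) (htree.measurable_C [i])
      ((htree.subtree i).measurable_weight n) (htree.indepFun_factor_weight n i) hD hD'
      (htail i) (hmean i) y hy
  have hX' : ∀ i y, y₀ ≤ y → P {ω | ENNReal.ofReal y < branch Nt Ct Qt n i ω}
      ≤ ENNReal.ofReal ((K * u * h + EQ * u * B) * T y) := fun i y hy =>
    hprod' (htree.identDistrib_C [i]) (htree.measurable_C [i])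
      ((htree.subtree i).measurable_weight n) (htree.indepFun_factor_weight n i) hD hD'
      (htail i) (hmean i) y hy
  have hNid : IdentDistrib (fun ω => (Nt [] ω : ℝ≥0∞)) (fun ω => (N ω : ℝ≥0∞)) P P :=
    (htree.identDistrib_N []).comp (u := fun n : ℕ => (n : ℝ≥0∞)) Measurable.of_discrete
  have key := measure_sum_random_gt_le (htree.measurable_N []) (htree.measurable_branch n)
    (htree.indepFun_branch_sum n) (fun m => htree.indepFun_root_sum n (Finset.range m))
    (a := ENNReal.ofReal (l * x)) (b := ENNReal.ofReal (d * x)) (k := ENNReal.ofReal (κ * x))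
    (p₁ := ENNReal.ofReal ((K * u * h + EQ * u * B) * T (l * x)))
    (q₁ := ENNReal.ofReal ((K * u + EQ * u) * B * T (κ * x)))
    (q₂ := ENNReal.ofReal (EC * EQ / (κ * x)))
    (A := ENNReal.ofReal (B₂ * ((K * u + EQ * u) * B + EC * EQ * u)
      * ((κ * x) ^ (p + 1) * T (κ * x))))
    (μ := ENNReal.ofReal (EC * EQ * u)) (M := ENNReal.ofReal M) p ENNReal.ofReal_ne_top
    (by simpa using by positivity) ENNReal.ofReal_ne_top (fun i => hX' i _ hlx)
    (fun i => hX i _ hκx)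
    (fun i => (measure_gt_le_div (htree.measurable_branch n i) (by positivity)
      (hmeanX i)).trans (ENNReal.ofReal_le_ofReal
        (div_le_div_of_nonneg_right (mul_le_of_le_one_right (by positivity) hu1) (by positivity))))
    (fun i => hmoment (htree.measurable_branch n i) (by positivity) (by positivity) (hX i)
      (hmeanX i) hκx) hmeanX
  have e1 : P {ω | ENNReal.ofReal M < (Nt [] ω : ℝ≥0∞)} = ENNReal.ofReal (T M) := by
    rw [← hNT M hM0]
    exact hNid.measure_mem_eq (measurableSet_Ioi (a := ENNReal.ofReal M))
  have e2 : ∫⁻ ω, (Nt [] ω : ℝ≥0∞) ∂P = ENNReal.ofReal EN := by rw [hNid.lintegral_eq, hEN]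
  have e3 : ∫⁻ ω, min (Nt [] ω : ℝ≥0∞)
      ((Nt [] ω : ℝ≥0∞) ^ 2 * ENNReal.ofReal (EC * EQ / (κ * x))) ∂P ≤ ENNReal.ofReal ε := by
    refine le_trans (le_of_eq ?_) (hq _ hxq)
    exact (hNid.comp (u := fun t : ℝ≥0∞ => min t (t ^ 2 * ENNReal.ofReal (EC * EQ / (κ * x))))
      (by fun_prop)).lintegral_eq
  have e4 : ∫⁻ ω, min (Nt [] ω : ℝ≥0∞) (ENNReal.ofReal M) ^ (p + 1) ∂P
      ≤ ENNReal.ofReal (B₂ * (1 + EN) * (M ^ (p + 1) * T M)) := by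
    refine le_trans (le_of_eq ?_) (hmoment hcast zero_le_one hEN0 (fun y hy => ?_) hEN.le
      (hx1.trans hxM))
    · exact (hNid.comp (u := fun t : ℝ≥0∞ => min t (ENNReal.ofReal M) ^ (p + 1))
        (by fun_prop)).lintegral_eq
    · rw [hNT y (by linarith), one_mul]
  have e5 : ((2 : ℝ≥0∞) ^ (p + 1)) ^ (p + 2) / ENNReal.ofReal (d * x) ^ (p + 1)
      = ENNReal.ofReal (cp / x ^ (p + 1)) := by
    have : cp / x ^ (p + 1) = (2 ^ (p + 1)) ^ (p + 2) / (d * x) ^ (p + 1) := by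
      rw [hcp, mul_pow, div_div]
    rw [this, ENNReal.ofReal_div_of_pos (by positivity), ENNReal.ofReal_pow (by positivity),
      ENNReal.ofReal_pow (by positivity), ENNReal.ofReal_pow (by positivity), ENNReal.ofReal_ofNat]
  rw [e1, e2, e5, ← ENNReal.ofReal_add (by positivity) (by positivity),
    show l * x + d * x = x by rw [hd]; ring] at key
  refine key.trans ?_
  set q₁ : ℝ := (K * u + EQ * u) * B * T (κ * x) with hq₁
  set AA : ℝ := B₂ * ((K * u + EQ * u) * B + EC * EQ * u) * ((κ * x) ^ (p + 1) * T (κ * x)) with hAA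
  set p₁ : ℝ := (K * u * h + EQ * u * B) * T (l * x) with hp₁
  have hTl0 := hT.pos (l * x) (by positivity)
  calc _ ≤ ENNReal.ofReal (T M) + ENNReal.ofReal EN * ENNReal.ofReal p₁
        + ENNReal.ofReal q₁ * ENNReal.ofReal ε + ENNReal.ofReal (cp / x ^ (p + 1)) *
          (ENNReal.ofReal EN * ENNReal.ofReal AA + ENNReal.ofReal (EC * EQ * u) ^ (p + 1) *
            ENNReal.ofReal (B₂ * (1 + EN) * (M ^ (p + 1) * T M))) := by gcongr
    _ = ENNReal.ofReal (T M + EN * p₁ + q₁ * ε + cp / x ^ (p + 1) *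
          (EN * AA + (EC * EQ * u) ^ (p + 1) * (B₂ * (1 + EN) * (M ^ (p + 1) * T M)))) := by
        rw [← ENNReal.ofReal_mul (by positivity), ← ENNReal.ofReal_mul (by positivity),
          ← ENNReal.ofReal_mul (by positivity), ← ENNReal.ofReal_pow (by positivity),
          ← ENNReal.ofReal_mul (by positivity), ← ENNReal.ofReal_add (by positivity)
          (by positivity), ← ENNReal.ofReal_add (by positivity) (by positivity),
          ← ENNReal.ofReal_add (by positivity) (by positivity),
          ← ENNReal.ofReal_mul (by positivity), ← ENNReal.ofReal_add (by positivity)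
          (by positivity)]
    _ ≤ _ := by
        refine ENNReal.ofReal_le_ofReal ?_
        have t2 : EN * p₁ ≤ (EN * h * r * K + EN * EQ * B * r) * (u * T x) := by
          calc EN * p₁ ≤ EN * ((K * u * h + EQ * u * B) * (r * T x)) := by
                rw [hp₁]; gcongr
            _ = _ := by ring
        have t3 : q₁ * ε ≤ (g / 3 * K + EQ * (g / 3)) * (u * T x) := by
          calc q₁ * ε ≤ (K * u + EQ * u) * B * (A₂ * κ ^ (-s) * T x) * ε := by
                rw [hq₁]; gcongr
            _ = (K + EQ) * (B * A₂ * κ ^ (-s) * ε) * (u * T x) := by ring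
            _ = (K + EQ) * (g / 3) * (u * T x) := by
                rw [hε, mul_div_cancel₀ _ (by positivity)]
            _ = _ := by ring
        have t4 : cp / x ^ (p + 1) * (EN * AA)
            ≤ (g / 3 * K + G * (EQ * B + EC * EQ)) * (u * T x) := by
          calc cp / x ^ (p + 1) * (EN * AA)
              = cp * EN * B₂ * ((K + EQ) * B + EC * EQ) * u * (κ ^ (p + 1) * T (κ * x)) := by
                rw [hAA, mul_pow]; field_simp
            _ ≤ cp * EN * B₂ * ((K + EQ) * B + EC * EQ) * u *
                  (κ ^ (p + 1) * (A₂ * κ ^ (-s) * T x)) := by gcongr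
            _ = G * ((K + EQ) * B + EC * EQ) * (u * T x) * (κ ^ (p + 1) * κ ^ (-s)) := by
                rw [hG]; ring
            _ ≤ G * ((K + EQ) * B + EC * EQ) * (u * T x) * κ := by gcongr
            _ = (G * B * κ * K + G * (EQ * B + EC * EQ) * κ) * (u * T x) := by ring
            _ ≤ (g / 3 * K + G * (EQ * B + EC * EQ) * 1) * (u * T x) := by gcongr
            _ = _ := by ring
        have t5 : cp / x ^ (p + 1) *
              ((EC * EQ * u) ^ (p + 1) * (B₂ * (1 + EN) * (M ^ (p + 1) * T M)))
            ≤ cp * (EC * EQ) ^ (p + 1) * B₂ * (1 + EN) * A₁ * (u * T x) := by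
          calc cp / x ^ (p + 1) *
              ((EC * EQ * u) ^ (p + 1) * (B₂ * (1 + EN) * (M ^ (p + 1) * T M)))
              = cp * (EC * EQ) ^ (p + 1) * B₂ * (1 + EN) * T M := by
                rw [hM, mul_pow, div_pow]; field_simp
            _ ≤ cp * (EC * EQ) ^ (p + 1) * B₂ * (1 + EN) * (A₁ * u * T x) := by gcongr
            _ = _ := by ring
        calc _ = T M + EN * p₁ + q₁ * ε + (cp / x ^ (p + 1) * (EN * AA) + cp / x ^ (p + 1) *
              ((EC * EQ * u) ^ (p + 1) * (B₂ * (1 + EN) * (M ^ (p + 1) * T M)))) := by ring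
          _ ≤ A₁ * u * T x + (EN * h * r * K + EN * EQ * B * r) * (u * T x)
              + (g / 3 * K + EQ * (g / 3)) * (u * T x)
              + ((g / 3 * K + G * (EQ * B + EC * EQ)) * (u * T x)
                + cp * (EC * EQ) ^ (p + 1) * B₂ * (1 + EN) * A₁ * (u * T x)) := by gcongr
          _ = _ := by rw [hc]; ring

end IsIIDTree

/-! ### Conclusion. -/

theorem integrable_of_rpow {Ω : Type*} [MeasurableSpace Ω] {P : Measure Ω} [IsFiniteMeasure P]
    {V : Ω → ℝ} (hV : Measurable V) (hV0 : ∀ᵐ ω ∂P, 0 ≤ V ω) {s : ℝ} (hs : 1 ≤ s)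
    (hmom : Integrable (fun ω => V ω ^ s) P) : Integrable V P := by
  refine Integrable.mono' ((integrable_const (1 : ℝ)).add hmom) hV.aestronglyMeasurable ?_
  filter_upwards [hV0] with ω hω
  rw [Real.norm_of_nonneg hω]
  simp only [Pi.add_apply]
  rcases le_total (V ω) 1 with h1 | h1
  · have := Real.rpow_nonneg hω s
    linarith
  · have := Real.rpow_le_rpow_of_exponent_le h1 hs
    rw [Real.rpow_one] at this
    linarith

end WeightedBranching

open WeightedBranching in
theorem proposition1 {Ω : Type*} [MeasurableSpace Ω] (P : Measure Ω) [IsProbabilityMeasure P]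
    (N : Ω → ℕ) (C Q : Ω → ℝ)
    (hN : Measurable N) (hC : Measurable C) (hQ : Measurable Q)
    (hC0 : ∀ᵐ ω ∂P, 0 ≤ C ω) (hQ0 : ∀ᵐ ω ∂P, 0 ≤ Q ω)
    (Nt : List ℕ → Ω → ℕ) (Ct Qt : List ℕ → Ω → ℝ)
    (htree : WeightedBranching.IsIIDTree P N C Q Nt Ct Qt)
    (α ν η : ℝ) (L : ℝ → ℝ) (hα : 1 < α) (hν : 0 < ν)
    (hL : SlowlyVarying L)
    (htail : ∀ x : ℝ, 0 < x → P.real {ω | x < (N ω : ℝ)} = x ^ (-α) * L x)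
    (hCmom : Integrable (fun ω => C ω ^ (α + ν)) P)
    (hQmom : Integrable (fun ω => Q ω ^ (α + ν)) P)
    (hη : (∫ ω, (N ω : ℝ) ∂P) * max (∫ ω, C ω ^ α ∂P) (∫ ω, C ω ∂P) < η)
    (hη1 : η < 1) :
    ∃ K : ℝ, 0 < K ∧ ∀ n : ℕ, 1 ≤ n → ∀ x : ℝ, 1 ≤ x →
      P.real {ω | x < WeightedBranching.totalWeight
          (fun v => Nt v ω) (fun v => Ct v ω) (fun v => Qt v ω) n}
        ≤ K * η ^ n * P.real {ω | x < (N ω : ℝ)} := by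
  set T : ℝ → ℝ := fun x => P.real {ω | x < (N ω : ℝ)} with hTdef
  have hs1 : 1 < α + ν := by linarith
  have hαs : α < α + ν := by linarith
  have hNr : Measurable fun ω => (N ω : ℝ) :=
    (Measurable.of_discrete (f := fun n : ℕ => (n : ℝ))).comp hN
  have hT : RegularTail T α := .of_slowlyVarying hL
    (fun x y hxy => measureReal_mono fun ω hω => by
      rw [Set.mem_ofPred_eq] at *
      exact hxy.trans_lt hω) htail
  have hNT : ∀ y, 0 < y → P {ω | ENNReal.ofReal y < (N ω : ENNReal)} = ENNReal.ofReal (T y) := by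
    intro y hy
    rw [hTdef, ofReal_measureReal]
    congr 1
    ext ω
    rw [Set.mem_ofPred_eq, Set.mem_ofPred_eq, ← ENNReal.ofReal_natCast,
      ENNReal.ofReal_lt_ofReal_iff_of_nonneg hy.le]
  have hNfin : ∫⁻ ω, ENNReal.ofReal (N ω : ℝ) ∂P < ⊤ :=
    hT.lintegral_lt_top hα hNr (fun ω => Nat.cast_nonneg _) fun y _ => by
      rw [hTdef, ofReal_measureReal]
  have hNint : Integrable (fun ω => (N ω : ℝ)) P :=
    ⟨hNr.aestronglyMeasurable, (hasFiniteIntegral_iff_ofReal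
      (ae_of_all _ fun ω => Nat.cast_nonneg _)).2 hNfin⟩
  have hCint := integrable_of_rpow hC hC0 hs1.le hCmom
  have hQint := integrable_of_rpow hQ hQ0 hs1.le hQmom
  have hEN0 : 0 ≤ ∫ ω, (N ω : ℝ) ∂P := integral_nonneg fun ω => Nat.cast_nonneg _
  have hEC0 : 0 ≤ ∫ ω, C ω ∂P := integral_nonneg_of_ae hC0
  have hEQ0 : 0 ≤ ∫ ω, Q ω ∂P := integral_nonneg_of_ae hQ0
  have hEN : ∫⁻ ω, (N ω : ENNReal) ∂P = ENNReal.ofReal (∫ ω, (N ω : ℝ) ∂P) := by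
    rw [ofReal_integral_eq_lintegral_ofReal hNint (ae_of_all _ fun ω => Nat.cast_nonneg _)]
    simp
  have hEC := (ofReal_integral_eq_lintegral_ofReal hCint hC0).symm
  have hEQ := (ofReal_integral_eq_lintegral_ofReal hQint hQ0).symm
  have hη0 : 0 < η := lt_of_le_of_lt (mul_nonneg hEN0 (le_max_of_le_right hEC0)) hη
  have hηC : (∫ ω, (N ω : ℝ) ∂P) * ∫ ω, C ω ∂P ≤ η :=
    (mul_le_mul_of_nonneg_left (le_max_right _ _) hEN0).trans hη.le
  have hηα : (∫ ω, (N ω : ℝ) ∂P) * ∫ ω, C ω ^ α ∂P < η :=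
    (mul_le_mul_of_nonneg_left (le_max_left _ _) hEN0).trans_lt hη
  obtain ⟨θ, c, x₀, hθ, hc, hx₀, hstep⟩ := IsIIDTree.exists_tail_succ (Q := Q) hT hα hαs hN hC hC0
    hCmom hNT hEN0 hEC0 hEQ0 hEN hEC hEQ hη0 hη1 hηC hηα
  obtain ⟨B, hB, hbase, -⟩ := hT.measure_mul_gt_le (by linarith) hαs hs1.le hQ hQ0 hQmom
  have hTx₀ := hT.pos x₀ (by linarith)
  have hηθ : 0 < η - θ := by linarith
  set EQ : ℝ := ∫ ω, Q ω ∂P with hEQdef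
  -- The three terms serve generation 0, the inequality θK + c ≤ ηK, and the range 1 ≤ x ≤ x₀.
  set K : ℝ := B + c / (η - θ) + EQ / T x₀ with hK
  have hK1 : 0 ≤ c / (η - θ) := by positivity
  have hK2 : 0 ≤ EQ / T x₀ := by positivity
  have hK0 : 0 < K := by linarith
  -- The tree is quantified inside the induction, since the hypothesis is applied to the subtrees of
  -- the root's children.
  have main : ∀ n : ℕ, ∀ {Nt : List ℕ → Ω → ℕ} {Ct Qt : List ℕ → Ω → ℝ}
      (_ : IsIIDTree P N C Q Nt Ct Qt) (x : ℝ) (_ : 1 ≤ x),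
      P {ω | ENNReal.ofReal x < recWeight n (fun v => Nt v ω) (fun v => Ct v ω)
        (fun v => Qt v ω)} ≤ ENNReal.ofReal (K * η ^ n * T x) := by
    intro n
    induction n with
    | zero =>
      intro Nt Ct Qt h x hx
      have hTx := hT.pos x (by linarith)
      -- Generation 0 is the product of Q with the constant 1, whose tail vanishes beyond 1: hence
      -- `D = 0` and `D' = 1`.
      have h1 := hbase (h.identDistrib_Q []) (h.measurable_Q []) (w := fun _ => 1)
        measurable_const (indepFun_const_right _ 1) (D := 0) (D' := 1) le_rfl zero_le_one
        (fun y hy => by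
          have : ¬ ENNReal.ofReal y < 1 := by simpa using hy
          simp [this]) (by simp) x hx
      simp only [mul_one] at h1
      refine h1.trans (ENNReal.ofReal_le_ofReal ?_)
      rw [pow_zero, zero_add, one_mul, mul_one]
      gcongr
      linarith
    | succ n ih =>
      intro Nt Ct Qt h x hx
      have hTx := hT.pos x (by linarith)
      rcases le_total x₀ x with hxx | hxx
      · refine (hstep K hK0.le n h (fun i => ih (h.subtree i)) x hxx).trans
          (ENNReal.ofReal_le_ofReal ?_)
        have h2 : c ≤ (η - θ) * K := by
          rw [← div_le_iff₀' hηθ]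
          linarith
        calc (θ * K + c) * η ^ n * T x ≤ (η * K) * η ^ n * T x := by gcongr; linarith
          _ = _ := by ring
      · refine (measure_gt_le_div (h.measurable_weight (n + 1)) (D := EQ * η ^ (n + 1))
          (by linarith) ?_).trans (ENNReal.ofReal_le_ofReal ?_)
        · refine (IsIIDTree.lintegral_weight_le (n + 1) h).trans ?_
          rw [hEN, hEC, hEQ, ← ENNReal.ofReal_mul hEN0, ← ENNReal.ofReal_pow (by positivity),
            ← ENNReal.ofReal_mul (by positivity), mul_comm]
          gcongr
        · have h3 : EQ ≤ K * T x := by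
            calc EQ = EQ / T x₀ * T x₀ := by field_simp
              _ ≤ K * T x := by
                gcongr
                · linarith
                · exact hT.anti hxx
          calc EQ * η ^ (n + 1) / x ≤ EQ * η ^ (n + 1) := div_le_self (by positivity) hx
            _ ≤ K * T x * η ^ (n + 1) := by gcongr
            _ = _ := by ring
  refine ⟨K, hK0, fun n _ x hx => ?_⟩
  have hTx := hT.pos x (by linarith)
  -- The recursive weight truncates negative values to 0, so it agrees with the real one only almost
  -- surely; there are countably many individuals.
  have hCt : ∀ᵐ ω ∂P, ∀ v, 0 ≤ Ct v ω := ae_all_iff.2 fun v =>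
    (htree.identDistrib_C v).symm.ae_snd measurableSet_Ici hC0
  have hQt : ∀ᵐ ω ∂P, ∀ v, 0 ≤ Qt v ω := ae_all_iff.2 fun v =>
    (htree.identDistrib_Q v).symm.ae_snd measurableSet_Ici hQ0
  refine ENNReal.toReal_le_of_le_ofReal (by positivity) (le_trans ?_ (main n htree x hx))
  refine measure_mono_ae ?_
  filter_upwards [hCt, hQt] with ω h1 h2 hω
  change ENNReal.ofReal x < _
  rw [← ofReal_totalWeight n h1 h2, ENNReal.ofReal_lt_ofReal_iff_of_nonneg (by linarith)]
  exact hω
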